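/- Let $\mathcal H$ be a simple hypergraph with finite vertex set $V$; that is, its edges are nonempty subsets of $V$ and no edge contains another. Let $\Delta_{\mathcal H}$ be its independence complex, whose faces are the subsets of $V$ containing no edge; let $K$ be a field, $R=K[x_v : v\in V]$ with the standard grading, and let $I_{\Delta_{\mathcal H}}$ be the Stanley–Reisner ideal of $\Delta_{\mathcal H}$, generated by the monomials $\prod_{v\in F}x_v$ for $F\subseteq V$ not a face. Write $\operatorname{reg}(M)=\max\{j-i : \beta_{i,j}(M)\neq 0\}$ for the Castelnuovo–Mumford regularity, where $\beta_{i,j}$ are the graded Betti numbers over $R$. A set $\{E_1,\dots,E_k\}$ of $k$ distinct edges ($k\ge 0$) is a semi induced matching if the only edges contained in $\bigcup_{\ell}E_\ell$ are $E_1,\dots,E_k$, and an induced matching if moreover the $E_\ell$ are pairwise disjoint. Let $c_{\mathcal H}$ (resp. $c'_{\mathcal H}$) be the maximum of $|\bigcup_{\ell=1}^k E_\ell|-k$ over all induced (resp. semi induced) matchings $\{E_1,\dots,E_k\}$ of $\mathcal H$. $\mathcal H$ is $C_n$-free if there are no distinct vertices $x_1,\dots,x_n$ and distinct edges $E_1,\dots,E_n$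 with $x_i,x_{i+1}\in E_i$ for $1\le i\le n-1$ and $x_n,x_1\in E_n$; it is $(C_2,C_5)$-free if it is both $C_2$-free and $C_5$-free. A simplicial complex $\Delta$ on a finite vertex set $V$ (where a vertex need not be a face) is vertex decomposable if its only facet is $V$, or it has no faces at all, or there is $x\in V$ such that the deletion $\{F\in\Delta : x\notin F\}$ and the link $\{F : x\notin F,\ F\cup\{x\}\in\Delta\}$, both on the vertex set $V\setminus\{x\}$, are vertex decomposable and every facet of the deletion is a facet of $\Delta$. $\mathcal H$ is vertex decomposable if $\Delta_{\mathcal H}$ is. Then: (1) $c_{\mathcal H}\le c'_{\mathcal H}\le \dim(\Delta_{\mathcal H})+1$ (for every such $\mathcal H$). (2) If $\mathcal H$ is $(C_2,C_5)$-free and vertex decomposable, then $$\operatorname{reg}(R/I_{\Delta_{\mathcal H}})\le c'_{\mathcal H}\le \dim(\Delta_{\mathcal H})+1.$$ -/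

import Mathlib

/-! ### Simplicial complexes -/

/-- A simplicial complex on the vertex set `vertices`: a downward closed family of subsets of
`vertices`. The empty set is a face as soon as there is a face; the family with no face at all
(the void complex) is allowed; a vertex need not be a face. -/
@[ext]
structure VertexComplex (α : Type*) where
  vertices : Set α
  faces : Set (Set α)
  subset_vertices : ∀ F ∈ faces, F ⊆ vertices
  down_closed : ∀ F ∈ faces, ∀ G, G ⊆ F → G ∈ faces

namespace VertexComplex

variable {α : Type*}

/-- The facets are the faces that are maximal with respect to inclusion. -/
def facets (Δ : VertexComplex α) : Set (Set α) :=
  {F | F ∈ Δ.faces ∧ ∀ G ∈ Δ.faces, F ⊆ G → G = F}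

/-- The deletion of `x`: the faces that do not contain `x`, on the vertex set without `x`. -/
def deletion (Δ : VertexComplex α) (x : α) : VertexComplex α where
  vertices := Δ.vertices \ {x}
  faces := {F | F ∈ Δ.faces ∧ x ∉ F}
  subset_vertices F hF _ hy :=
    ⟨Δ.subset_vertices F hF.1 hy, fun h => hF.2 (Set.mem_singleton_iff.1 h ▸ hy)⟩
  down_closed F hF G hG := ⟨Δ.down_closed F hF.1 G hG, fun h => hF.2 (hG h)⟩

/-- The link of `x`: the sets `F` with `x ∉ F` and `F ∪ {x}` a face, on the vertex set
without `x`. -/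
def link (Δ : VertexComplex α) (x : α) : VertexComplex α where
  vertices := Δ.vertices \ {x}
  faces := {F | x ∉ F ∧ insert x F ∈ Δ.faces}
  subset_vertices _ hF _ hy :=
    ⟨Δ.subset_vertices _ hF.2 (Set.mem_insert_of_mem x hy),
      fun h => hF.1 (Set.mem_singleton_iff.1 h ▸ hy)⟩
  down_closed _ hF _ hG :=
    ⟨fun h => hF.1 (hG h), Δ.down_closed _ hF.2 _ (Set.insert_subset_insert hG)⟩

/-- Vertex decomposable complexes: the simplex on the whole vertex set, the complex without
faces, and every complex with a vertex `x` whose deletion and link are vertex decomposable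
and such that every facet of the deletion of `x` is a facet of the complex. -/
inductive VertexDecomposable : VertexComplex α → Prop
  | simplex (Δ : VertexComplex α) (h : Δ.facets = {Δ.vertices}) : VertexDecomposable Δ
  | void (Δ : VertexComplex α) (h : Δ.faces = ∅) : VertexDecomposable Δ
  | shedding (Δ : VertexComplex α) (x : α) (hx : x ∈ Δ.vertices)
      (hdel : VertexDecomposable (Δ.deletion x)) (hlink : VertexDecomposable (Δ.link x))
      (hshed : ∀ F ∈ (Δ.deletion x).facets, F ∈ Δ.facets) : VertexDecomposable Δ

/-- The dimension `max {|F| - 1 : F a face}` of a complex that has a face and whose vertex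
set is finite. -/
noncomputable def dim (Δ : VertexComplex α) : ℤ :=
  sSup {d : ℤ | ∃ F ∈ Δ.faces, d = (F.ncard : ℤ) - 1}

/-- The Stanley-Reisner ideal: it is generated by the squarefree monomials `∏ x ∈ F, X x` for
the sets `F` of vertices that are not faces. -/
noncomputable def stanleyReisnerIdeal (K : Type*) [Field K] (Δ : VertexComplex α) :
    Ideal (MvPolynomial Δ.vertices K) :=
  Ideal.span {p | ∃ F : Finset Δ.vertices,
    (Subtype.val '' (F : Set Δ.vertices)) ∉ Δ.faces ∧ p = ∏ x ∈ F, MvPolynomial.X x}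

end VertexComplex

/-! ### Hypergraphs -/

namespace Hypergraph

variable {α : Type*}

/-- A hypergraph is simple if no edge contains another edge. -/
def IsSimple (H : Hypergraph α) : Prop :=
  ∀ e ∈ H.edgeSet, ∀ f ∈ H.edgeSet, e ⊆ f → e = f

/-- The independence complex: its faces are the sets of vertices that contain no edge. -/
def independenceComplex (H : Hypergraph α) : VertexComplex α where
  vertices := H.vertexSet
  faces := {F | F ⊆ H.vertexSet ∧ ∀ e ∈ H.edgeSet, ¬ e ⊆ F}
  subset_vertices _ hF := hF.1
  down_closed _ hF _ hG := ⟨hG.trans hF.1, fun e he h => hF.2 e he (h.trans hG)⟩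

/-- A hypergraph is vertex decomposable if its independence complex is. -/
def VertexDecomposable (H : Hypergraph α) : Prop :=
  H.independenceComplex.VertexDecomposable

/-- `H` contains a cycle of length `n`: distinct vertices `x 0, …, x (n - 1)` and distinct edges
`E 0, …, E (n - 1)` such that `x i` and `x (i + 1)` lie in `E i`, indices modulo `n`. -/
def HasCycle (H : Hypergraph α) (n : ℕ) : Prop :=
  ∃ (x : Fin n → α) (E : Fin n → Set α), Function.Injective x ∧ Function.Injective E ∧
    ∀ i, E i ∈ H.edgeSet ∧ x i ∈ E i ∧ x (finRotate n i) ∈ E i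

/-- `H` is `C_n`-free. -/
def CycleFree (H : Hypergraph α) (n : ℕ) : Prop := ¬ H.HasCycle n

/-- A semi induced matching: a set of edges that contains all the edges contained in its
union. -/
def IsSemiInducedMatching (H : Hypergraph α) (M : Set (Set α)) : Prop :=
  M ⊆ H.edgeSet ∧ ∀ e ∈ H.edgeSet, e ⊆ ⋃₀ M → e ∈ M

/-- An induced matching: a semi induced matching whose edges are pairwise disjoint. -/
def IsInducedMatching (H : Hypergraph α) (M : Set (Set α)) : Prop :=
  H.IsSemiInducedMatching M ∧ M.PairwiseDisjoint id

/-- The induced matching number `c_H`, the maximum of `|E₁ ∪ ⋯ ∪ E_k| - k` over the induced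
matchings `{E₁, …, E_k}`. (For a finite vertex set this is the maximum of a finite nonempty
set of integers.) -/
noncomputable def inducedMatchingNumber (H : Hypergraph α) : ℤ :=
  sSup {m : ℤ | ∃ M, H.IsInducedMatching M ∧ m = ((⋃₀ M).ncard : ℤ) - (M.ncard : ℤ)}

/-- The semi induced matching number `c'_H`, the maximum of `|E₁ ∪ ⋯ ∪ E_k| - k` over the semi
induced matchings `{E₁, …, E_k}`. -/
noncomputable def semiInducedMatchingNumber (H : Hypergraph α) : ℤ :=
  sSup {m : ℤ | ∃ M, H.IsSemiInducedMatching M ∧ m = ((⋃₀ M).ncard : ℤ) - (M.ncard : ℤ)}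

end Hypergraph

/-! ### Graded Betti numbers and Castelnuovo-Mumford regularity -/

/-- A minimal graded free resolution
`⋯ → F₂ → F₁ → F₀ → M → 0` of a module `M` over the polynomial ring `R = K[x_s : s ∈ σ]` with
its standard grading, where `gr j` is the homogeneous component of degree `j` of `M`.
The module `F_i` is `⨁ a, R(-deg i a)`, free of finite rank `rank i`, with the standard basis
element of index `a` in degree `deg i a`; the maps are homogeneous of degree `0`. -/
structure MinimalGradedFreeResolution (σ K : Type*) [Field K] (M : Type*) [AddCommGroup M]
    [Module K M] [Module (MvPolynomial σ K) M] (gr : ℕ → Submodule K M) where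
  rank : ℕ → ℕ
  deg : (i : ℕ) → Fin (rank i) → ℕ
  /-- the differential `F_{i+1} → F_i` -/
  d : (i : ℕ) → (Fin (rank (i + 1)) → MvPolynomial σ K) →ₗ[MvPolynomial σ K]
    (Fin (rank i) → MvPolynomial σ K)
  /-- the augmentation `F₀ → M` -/
  aug : (Fin (rank 0) → MvPolynomial σ K) →ₗ[MvPolynomial σ K] M
  aug_homogeneous : ∀ a, aug (Pi.single a 1) ∈ gr (deg 0 a)
  d_homogeneous : ∀ i b a, d i (Pi.single b 1) a = 0 ∨
    ∃ m, deg (i + 1) b = deg i a + m ∧ (d i (Pi.single b 1) a).IsHomogeneous m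
  aug_surjective : Function.Surjective aug
  exact_zero : Function.Exact (d 0) aug
  exact_succ : ∀ i, Function.Exact (d (i + 1)) (d i)
  /-- the matrices of the differentials have their entries in the ideal of the variables -/
  minimal : ∀ i b a, MvPolynomial.constantCoeff (d i (Pi.single b 1) a) = 0

/-- The graded Betti number `β_{i,j}` of a finitely generated graded module: the number of basis
elements of degree `j` in the `i`-th module of a minimal graded free resolution. (Any two minimal
graded free resolutions are isomorphic, so the supremum is over equal numbers.) -/
noncomputable def gradedBetti (σ K : Type*) [Field K] {M : Type*} [AddCommGroup M]
    [Module K M] [Module (MvPolynomial σ K) M] (gr : ℕ → Submodule K M) (i j : ℕ) : ℕ∞ :=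
  ⨆ F : MinimalGradedFreeResolution σ K M gr,
    ((Finset.univ.filter fun a => F.deg i a = j).card : ℕ∞)

/-- The Castelnuovo-Mumford regularity `max {j - i : β_{i,j} ≠ 0}`, as an extended real number
(it is `⊥` for the zero module). -/
noncomputable def regularity (σ K : Type*) [Field K] {M : Type*} [AddCommGroup M]
    [Module K M] [Module (MvPolynomial σ K) M] (gr : ℕ → Submodule K M) : EReal :=
  ⨆ (i : ℕ) (j : ℕ) (_ : gradedBetti σ K gr i j ≠ 0), (((j : ℝ) - (i : ℝ) : ℝ) : EReal)

/-- The homogeneous components of `R ⧸ I` for a homogeneous ideal `I`: the images of the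
homogeneous components of the polynomial ring `R`. -/
noncomputable def quotientGrading {σ K : Type*} [Field K] (I : Ideal (MvPolynomial σ K)) (j : ℕ) :
    Submodule K (MvPolynomial σ K ⧸ I) :=
  (MvPolynomial.homogeneousSubmodule σ K j).map (Ideal.Quotient.mkₐ K I).toLinearMap

/-- The regularity of the Stanley-Reisner ring `R ⧸ I_Δ`, where `R` is the polynomial ring over
`K` with one variable for each vertex of `Δ`. -/
noncomputable def VertexComplex.stanleyReisnerRegularity {α : Type*} (K : Type*) [Field K]
    (Δ : VertexComplex α) : EReal :=
  regularity Δ.vertices K (quotientGrading (Δ.stanleyReisnerIdeal K))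

/-!
The matching numbers are compared by removing one vertex from each edge of a semi induced
matching: what remains of the union contains no edge.

For the regularity, write `I` for the ideal of a complex and `x` for a shedding vertex.
Multiplication by the variable `x` gives an exact sequence
`0 → (R / (I : x))(-1) → R / I → R / (I + (x)) → 0`. The ideal `I : x` is that of the link
of `x`, and `I + (x)` is generated by `x` and the ideal of the deletion, in which `x`
does not occur. Hence `R / I` has regularity at most `r`
if the link has regularity at most `r - 1` and the deletion at most `r`
(`SquarefreeIdeal.regularityLE_of_link_of_deletion`). So it suffices that passing to the link of a
shedding vertex decreases the semi induced matching number
(`VertexComplex.exists_matching_of_link`). Given a semi induced matching of the link without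
one-element edges, either one of its edges comes from an edge through `x`, and then the matching
lifts to one with the additional vertex `x`; or an edge through `x` can be added to it. If no such
edge could be added, excluding cycles of lengths two and five produces a maximal face of the link
that is a facet of the deletion, against the choice of `x`
(`VertexComplex.exists_edge_of_shedding`).

Since regularity is defined by minimal free resolutions, it has to be linked to exact sequences.
This is done through the homology of the Koszul complex of the variables with coefficients in `R /
I`, which computes `Tor (R / I, K)`. The ideals of all complexes are taken in one polynomial ring,
so that the induction takes place over a fixed ring, and gradings are families of subgroups
indexed by the integers. The polynomial ring itself is acyclic
(`SquarefreeIdeal.vanishes_polynomial`), which allows dimension shifting along a minimal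
resolution: a generator of degree `j` in homological degree `i` yields a nonzero class of bidegree
`(i, j)` in the Koszul homology of `R / I` (`SquarefreeIdeal.deg_sub_le`).
-/

/-! ### Koszul complexes -/

namespace Koszul

set_option linter.unusedSectionVars false

variable {R : Type*} [CommRing R]

/-- The underlying module of the Koszul complex of a list of ring elements with coefficients in
`M`, built as an iterated mapping cone: `K(x :: l; M) = K(l; M) ⊕ K(l; M)`, the second summand
being the one shifted in homological degree. -/
def Chain (M : Type*) : List R → Type _
  | [] => M
  | _ :: l => Chain M l × Chain M l

/-- A chain of `K([]; M)`, which is an element of `M`. -/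
def Chain.nil {M : Type*} (m : M) : Chain M ([] : List R) := m

/-- A chain of `K(x :: l; M)`, which is a pair of chains of `K(l; M)`. -/
def Chain.cons {M : Type*} {x : R} {l : List R} (a b : Chain M l) : Chain M (x :: l) := (a, b)

theorem exists_eq_nil {M : Type*} (c : Chain M ([] : List R)) : ∃ m : M, c = Chain.nil m :=
  ⟨c, rfl⟩

theorem exists_eq_cons {M : Type*} {x : R} {l : List R} (c : Chain M (x :: l)) :
    ∃ a b : Chain M l, c = Chain.cons a b := ⟨c.1, c.2, rfl⟩

section Instances

variable (M : Type*) [AddCommGroup M] [Module R M]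

instance instAddCommGroup : ∀ l : List R, AddCommGroup (Chain M l)
  | [] => inferInstanceAs (AddCommGroup M)
  | _ :: l =>
    letI := instAddCommGroup l
    inferInstanceAs (AddCommGroup (Chain M l × Chain M l))

instance instModule : ∀ l : List R, Module R (Chain M l)
  | [] => inferInstanceAs (Module R M)
  | _ :: l =>
    letI := instModule l
    inferInstanceAs (Module R (Chain M l × Chain M l))

end Instances

section Maps

variable {M N P : Type*} [AddCommGroup M] [Module R M] [AddCommGroup N] [Module R N]
  [AddCommGroup P] [Module R P]

variable (M) in
/-- The Koszul differential, `d (a, b) = (d a + x b, - d b)` on the cone of `x`. -/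
def d : ∀ l : List R, Chain M l →ₗ[R] Chain M l
  | [] => 0
  | x :: l => LinearMap.prod (d l ∘ₗ LinearMap.fst R (Chain M l) (Chain M l) +
      x • LinearMap.snd R (Chain M l) (Chain M l))
      (-(d l ∘ₗ LinearMap.snd R (Chain M l) (Chain M l)))

/-- The map of Koszul complexes induced by a map of coefficients. -/
def map (f : M →ₗ[R] N) : ∀ l : List R, Chain M l →ₗ[R] Chain N l
  | [] => f
  | _ :: l => LinearMap.prodMap (map f l) (map f l)

/-- The chains of homological degree `i` whose coefficients have degree `k`, where `g` is a grading
of the module of coefficients. (Their internal degree in the Koszul complex of elements of degree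
one is `i + k`.) -/
def chains (g : ℤ → AddSubgroup M) : ∀ l : List R, ℤ → ℤ → AddSubgroup (Chain M l)
  | [], i, k => if i = 0 then g k else ⊥
  | _ :: l, i, k => (chains g l i k).prod (chains g l (i - 1) k)

/-- The projection of a chain to its component of homological degree `0`. -/
def toCoeff : ∀ l : List R, Chain M l →ₗ[R] M
  | [] => LinearMap.id
  | _ :: l => toCoeff l ∘ₗ LinearMap.fst R (Chain M l) (Chain M l)

/-- The inclusion of the coefficients as the chains of homological degree `0`. -/
def ofCoeff : ∀ l : List R, M →ₗ[R] Chain M l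
  | [] => LinearMap.id
  | _ :: l => LinearMap.inl R (Chain M l) (Chain M l) ∘ₗ ofCoeff l

theorem d_cons (x : R) (l : List R) (a b : Chain M l) :
    d M (x :: l) (Chain.cons a b) = Chain.cons (d M l a + x • b) (-d M l b) := rfl

theorem map_nil (f : M →ₗ[R] N) (m : M) :
    map f [] (Chain.nil m) = Chain.nil (f m) := rfl

theorem map_cons (f : M →ₗ[R] N) (x : R) (l : List R) (a b : Chain M l) :
    map f (x :: l) (Chain.cons a b) = Chain.cons (map f l a) (map f l b) := rfl

theorem ofCoeff_cons (x : R) (l : List R) (m : M) :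
    ofCoeff (x :: l) m = Chain.cons (ofCoeff l m) 0 := rfl

theorem toCoeff_cons (x : R) (l : List R) (a b : Chain M l) :
    toCoeff (x :: l) (Chain.cons a b) = toCoeff l a := rfl

theorem add_cons (x : R) (l : List R) (a b a' b' : Chain M l) :
    (Chain.cons a b + Chain.cons a' b' : Chain M (x :: l)) = Chain.cons (a + a') (b + b') := rfl

theorem smul_cons (r x : R) (l : List R) (a b : Chain M l) :
    r • (Chain.cons a b : Chain M (x :: l)) = Chain.cons (r • a) (r • b) := rfl

theorem mem_chains_cons {g : ℤ → AddSubgroup M} {x : R} {l : List R} {i k : ℤ}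
    {a b : Chain M l} :
    Chain.cons a b ∈ chains g (x :: l) i k ↔
      a ∈ chains g l i k ∧ b ∈ chains g l (i - 1) k := Iff.rfl

theorem mem_chains_nil {g : ℤ → AddSubgroup M} {i k : ℤ} {a : M} :
    Chain.nil a ∈ chains g ([] : List R) i k ↔
      (i = 0 ∧ a ∈ g k) ∨ (i ≠ 0 ∧ a = 0) := by
  change a ∈ (if i = 0 then g k else ⊥ : AddSubgroup M) ↔ _
  split_ifs with h <;> simp [h]

theorem cons_inj {x : R} {l : List R} {a b a' b' : Chain M l} :
    (Chain.cons a b : Chain M (x :: l)) = Chain.cons a' b' ↔ a = a' ∧ b = b' := Prod.mk_inj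

theorem nil_eq_zero {m : M} : (Chain.nil m : Chain M ([] : List R)) = 0 ↔ m = 0 := Iff.rfl

theorem cons_eq_zero {x : R} {l : List R} {a b : Chain M l} :
    (Chain.cons a b : Chain M (x :: l)) = 0 ↔ a = 0 ∧ b = 0 := Prod.mk_eq_zero

theorem d_d : ∀ (l : List R) (c : Chain M l), d M l (d M l c) = 0
  | [], _ => rfl
  | x :: l, c => by
    obtain ⟨a, b, rfl⟩ := exists_eq_cons c
    rw [d_cons, d_cons, cons_eq_zero]
    simp [d_d l]

theorem map_d (f : M →ₗ[R] N) : ∀ (l : List R) (c : Chain M l),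
    map f l (d M l c) = d N l (map f l c)
  | [], _ => map_zero f
  | x :: l, c => by
    obtain ⟨a, b, rfl⟩ := exists_eq_cons c
    rw [d_cons, map_cons, map_cons, d_cons, cons_inj]
    simp [map_d f l]

theorem map_map (f : M →ₗ[R] N) (h : N →ₗ[R] P) : ∀ (l : List R) (c : Chain M l),
    map h l (map f l c) = map (h ∘ₗ f) l c
  | [], _ => rfl
  | x :: l, c => by
    obtain ⟨a, b, rfl⟩ := exists_eq_cons c
    rw [map_cons, map_cons, map_cons, map_map f h l, map_map f h l]

theorem map_id : ∀ (l : List R) (c : Chain M l), map (LinearMap.id : M →ₗ[R] M) l c = c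
  | [], _ => rfl
  | x :: l, c => by
    obtain ⟨a, b, rfl⟩ := exists_eq_cons c
    rw [map_cons, map_id l, map_id l]

theorem map_zero_apply : ∀ (l : List R) (c : Chain M l), map (0 : M →ₗ[R] N) l c = 0
  | [], _ => rfl
  | x :: l, c => by
    obtain ⟨a, b, rfl⟩ := exists_eq_cons c
    rw [map_cons, map_zero_apply l, map_zero_apply l]; rfl

theorem map_add_apply (f h : M →ₗ[R] N) : ∀ (l : List R) (c : Chain M l),
    map (f + h) l c = map f l c + map h l c
  | [], _ => rfl
  | x :: l, c => by
    obtain ⟨a, b, rfl⟩ := exists_eq_cons c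
    rw [map_cons, map_add_apply f h l, map_add_apply f h l, map_cons, map_cons, add_cons]

theorem map_smul_id_apply (r : R) : ∀ (l : List R) (c : Chain M l),
    map (r • LinearMap.id : M →ₗ[R] M) l c = r • c
  | [], _ => rfl
  | x :: l, c => by
    obtain ⟨a, b, rfl⟩ := exists_eq_cons c
    rw [map_cons, map_smul_id_apply r l, map_smul_id_apply r l, smul_cons]

theorem map_sum_apply {ι : Type*} (s : Finset ι) (f : ι → M →ₗ[R] N) (l : List R)
    (c : Chain M l) : map (∑ a ∈ s, f a) l c = ∑ a ∈ s, map (f a) l c := by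
  classical
  induction s using Finset.induction_on with
  | empty => simp [map_zero_apply]
  | insert a s ha ih => rw [Finset.sum_insert ha, Finset.sum_insert ha, map_add_apply, ih]

theorem eq_zero_of_map_eq_zero {f : M →ₗ[R] N} (hf : ∀ m, f m = 0 → m = 0) :
    ∀ (l : List R) (c : Chain M l), map f l c = 0 → c = 0
  | [], c => hf c
  | x :: l, c => by
    obtain ⟨a, b, rfl⟩ := exists_eq_cons c
    rw [map_cons, cons_eq_zero, cons_eq_zero]
    exact fun h => ⟨eq_zero_of_map_eq_zero hf l a h.1, eq_zero_of_map_eq_zero hf l b h.2⟩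

theorem map_mem_chains {f : M →ₗ[R] N} {g : ℤ → AddSubgroup M} {g' : ℤ → AddSubgroup N}
    {k k' : ℤ} (hf : ∀ m ∈ g k, f m ∈ g' k') :
    ∀ (l : List R) (i : ℤ) (c : Chain M l), c ∈ chains g l i k → map f l c ∈ chains g' l i k'
  | [], i, c => by
    obtain ⟨m, hnil⟩ := exists_eq_nil c
    rw [hnil]
    rw [map_nil, mem_chains_nil, mem_chains_nil]
    rintro (⟨hi, hc⟩ | ⟨hi, hc⟩)
    · exact .inl ⟨hi, hf m hc⟩
    · exact .inr ⟨hi, by rw [hc, map_zero]⟩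
  | x :: l, i, c => by
    obtain ⟨a, b, rfl⟩ := exists_eq_cons c
    rw [map_cons, mem_chains_cons, mem_chains_cons]
    exact fun h => ⟨map_mem_chains hf l i a h.1, map_mem_chains hf l _ b h.2⟩

/-- A condition on the homogeneous coefficients carries over to homogeneous chains: if the
coefficients of degree `k'` killed by `h` are images under `f` of coefficients of degree `k`, then
so are the chains. -/
theorem exists_map_eq_of_map_eq_zero {f : M →ₗ[R] N} {h : N →ₗ[R] P} {g : ℤ → AddSubgroup M}
    {g' : ℤ → AddSubgroup N} {k k' : ℤ}
    (hf : ∀ n ∈ g' k', h n = 0 → ∃ m ∈ g k, f m = n) :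
    ∀ (l : List R) (i : ℤ) (c : Chain N l), c ∈ chains g' l i k' → map h l c = 0 →
      ∃ b ∈ chains g l i k, map f l b = c
  | [], i, c => by
    obtain ⟨n, hnil⟩ := exists_eq_nil c
    rw [hnil]
    rw [mem_chains_nil, map_nil, nil_eq_zero]
    rintro (⟨hi, hc⟩ | ⟨hi, hc⟩) h0
    · obtain ⟨m, hm, rfl⟩ := hf n hc h0
      exact ⟨Chain.nil m, mem_chains_nil.2 (.inl ⟨hi, hm⟩), rfl⟩
    · exact ⟨0, zero_mem _, by rw [map_zero, hc]; rfl⟩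
  | x :: l, i, c => by
    obtain ⟨a, b, rfl⟩ := exists_eq_cons c
    rw [map_cons, mem_chains_cons, cons_eq_zero]
    intro hc h0
    obtain ⟨a', ha', rfl⟩ := exists_map_eq_of_map_eq_zero hf l i a hc.1 h0.1
    obtain ⟨b', hb', rfl⟩ := exists_map_eq_of_map_eq_zero hf l (i - 1) b hc.2 h0.2
    exact ⟨Chain.cons a' b', mem_chains_cons.2 ⟨ha', hb'⟩, rfl⟩

theorem exists_map_eq {f : M →ₗ[R] N} {g : ℤ → AddSubgroup M} {g' : ℤ → AddSubgroup N} {k k' : ℤ}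
    (hf : ∀ n ∈ g' k', ∃ m ∈ g k, f m = n) (l : List R) (i : ℤ) (c : Chain N l)
    (hc : c ∈ chains g' l i k') : ∃ b ∈ chains g l i k, map f l b = c :=
  exists_map_eq_of_map_eq_zero (h := (0 : N →ₗ[R] N)) (fun n hn _ => hf n hn) l i c hc
    (map_zero_apply l c)

theorem smul_mem_chains {g : ℤ → AddSubgroup M} {x : R} {k : ℤ}
    (hx : ∀ m ∈ g k, x • m ∈ g (k + 1)) (l : List R) (i : ℤ) (c : Chain M l)
    (hc : c ∈ chains g l i k) : x • c ∈ chains g l i (k + 1) := by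
  rw [← map_smul_id_apply]
  exact map_mem_chains hx l i c hc

/-- If the listed elements have degree one, the differential lowers the homological degree by one
and raises the degree of the coefficients by one. -/
theorem d_mem_chains {g : ℤ → AddSubgroup M} {k : ℤ} :
    ∀ (l : List R) (_ : ∀ x ∈ l, ∀ m ∈ g k, x • m ∈ g (k + 1)) (i : ℤ) (c : Chain M l),
      c ∈ chains g l i k → d M l c ∈ chains g l (i - 1) (k + 1)
  | [], _, i, c, _ => zero_mem _
  | x :: l, hl, i, c, hc => by
    obtain ⟨a, b, rfl⟩ := exists_eq_cons c
    rw [mem_chains_cons] at hc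
    have ih := d_mem_chains l fun y hy => hl y (List.mem_cons_of_mem x hy)
    rw [d_cons, mem_chains_cons]
    exact ⟨add_mem (ih i a hc.1) (smul_mem_chains (hl x List.mem_cons_self) l _ b hc.2),
      neg_mem (ih _ b hc.2)⟩

theorem eq_zero_of_mem_chains_of_neg {g : ℤ → AddSubgroup M} {k : ℤ} :
    ∀ (l : List R) (i : ℤ) (_ : i < 0) (c : Chain M l), c ∈ chains g l i k → c = 0
  | [], i, hi, c => by
    obtain ⟨m, hnil⟩ := exists_eq_nil c
    rw [hnil]
    rw [mem_chains_nil]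
    rintro (⟨h, -⟩ | ⟨-, h⟩)
    · omega
    · exact nil_eq_zero.2 h
  | x :: l, i, hi, c => by
    obtain ⟨a, b, rfl⟩ := exists_eq_cons c
    rw [mem_chains_cons, cons_eq_zero]
    exact fun h => ⟨eq_zero_of_mem_chains_of_neg l i hi a h.1,
      eq_zero_of_mem_chains_of_neg l (i - 1) (by omega) b h.2⟩

theorem map_ofCoeff (f : M →ₗ[R] N) : ∀ (l : List R) (m : M),
    map f l (ofCoeff l m) = ofCoeff l (f m)
  | [], _ => rfl
  | x :: l, m => by
    rw [ofCoeff_cons, map_cons, map_ofCoeff f l m, map_zero, ofCoeff_cons]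

theorem toCoeff_ofCoeff : ∀ (l : List R) (m : M), toCoeff l (ofCoeff l m) = m
  | [], _ => rfl
  | _ :: l, m => toCoeff_ofCoeff l m

theorem toCoeff_map (f : M →ₗ[R] N) : ∀ (l : List R) (c : Chain M l),
    toCoeff l (map f l c) = f (toCoeff l c)
  | [], _ => rfl
  | x :: l, c => by
    obtain ⟨a, b, rfl⟩ := exists_eq_cons c
    rw [map_cons, toCoeff_cons, toCoeff_cons, toCoeff_map f l]

theorem d_ofCoeff : ∀ (l : List R) (m : M), d M l (ofCoeff l m) = 0
  | [], _ => rfl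
  | x :: l, m => by
    rw [ofCoeff_cons, d_cons, cons_eq_zero]
    simp [d_ofCoeff l m]

theorem ofCoeff_mem_chains {g : ℤ → AddSubgroup M} {k : ℤ} {m : M} (hm : m ∈ g k) :
    ∀ l : List R, ofCoeff l m ∈ chains g l 0 k
  | [] => mem_chains_nil.2 (.inl ⟨rfl, hm⟩)
  | _ :: l => mem_chains_cons.2 ⟨ofCoeff_mem_chains hm l, zero_mem _⟩

theorem eq_ofCoeff_of_mem_chains {g : ℤ → AddSubgroup M} {k : ℤ} :
    ∀ (l : List R) (c : Chain M l), c ∈ chains g l 0 k →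
      toCoeff l c ∈ g k ∧ c = ofCoeff l (toCoeff l c)
  | [], c => by
    obtain ⟨m, hnil⟩ := exists_eq_nil c
    rw [hnil]
    rw [mem_chains_nil]
    rintro (⟨-, h⟩ | ⟨h, -⟩)
    · exact ⟨h, rfl⟩
    · exact absurd rfl h
  | x :: l, c => by
    obtain ⟨a, b, rfl⟩ := exists_eq_cons c
    rw [mem_chains_cons]
    rintro ⟨ha, hb⟩
    obtain ⟨h1, h2⟩ := eq_ofCoeff_of_mem_chains l a ha
    rw [toCoeff_cons, ofCoeff_cons, cons_inj]
    exact ⟨h1, h2, eq_zero_of_mem_chains_of_neg l _ (by omega) b hb⟩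

/-- A functional that vanishes on multiples of the listed elements vanishes on boundaries of
homological degree `0`. -/
theorem apply_toCoeff_d {G : Type*} [AddCommGroup G] (π : M →+ G) :
    ∀ (l : List R) (_ : ∀ x ∈ l, ∀ m, π (x • m) = 0) (c : Chain M l), π (toCoeff l (d M l c)) = 0
  | [], _, _ => map_zero π
  | x :: l, hl, c => by
    obtain ⟨a, b, rfl⟩ := exists_eq_cons c
    rw [d_cons, toCoeff_cons, map_add, map_smul, map_add, hl x List.mem_cons_self,
      apply_toCoeff_d π l (fun y hy => hl y (List.mem_cons_of_mem x hy)), add_zero]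

/-! ### Vanishing of Koszul homology -/

/-- The Koszul homology in homological degree `i` and coefficient degree `k` vanishes. -/
def HomologyVanishes (l : List R) (g : ℤ → AddSubgroup M) (i k : ℤ) : Prop :=
  ∀ c ∈ chains g l i k, d M l c = 0 → ∃ b ∈ chains g l (i + 1) (k - 1), d M l b = c

theorem chains_shift (g : ℤ → AddSubgroup M) (s : ℤ) : ∀ (l : List R) (i k : ℤ),
    chains (fun k => g (k - s)) l i k = chains g l i (k - s)
  | [], _, _ => rfl
  | _ :: l, i, k => congrArg₂ AddSubgroup.prod (chains_shift g s l i k)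
      (chains_shift g s l (i - 1) k)

theorem homologyVanishes_shift {l : List R} {g : ℤ → AddSubgroup M} {s i k : ℤ} :
    HomologyVanishes l (fun k => g (k - s)) i k ↔ HomologyVanishes l g i (k - s) := by
  unfold HomologyVanishes
  rw [chains_shift, chains_shift, sub_right_comm]

/-- The grading `g` is compatible with the listed elements, each taken to have degree one. -/
def Compatible (l : List R) (g : ℤ → AddSubgroup M) : Prop :=
  ∀ x ∈ l, ∀ k, ∀ m ∈ g k, x • m ∈ g (k + 1)

theorem Compatible.d_mem {l : List R} {g : ℤ → AddSubgroup M} (hg : Compatible l g) {i k i' k' : ℤ}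
    {c : Chain M l} (hc : c ∈ chains g l i k) (hi : i' = i - 1) (hk : k' = k + 1) :
    d M l c ∈ chains g l i' k' := by
  subst hi hk
  exact d_mem_chains l (fun x hx => hg x hx k) i c hc

/-- A short exact sequence `0 → A → B → C → 0` of graded modules, where exactness is only asked for
homogeneous elements. The gradings are families of subgroups of ambient modules, which need not
span them; so a graded submodule of `B` can be given with ambient module `B`. -/
structure GradedExact {A B C : Type*} [AddCommGroup A] [Module R A] [AddCommGroup B] [Module R B]
    [AddCommGroup C] [Module R C] (gA : ℤ → AddSubgroup A) (gB : ℤ → AddSubgroup B)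
    (gC : ℤ → AddSubgroup C) (f : A →ₗ[R] B) (h : B →ₗ[R] C) : Prop where
  inj : ∀ a, f a = 0 → a = 0
  map_left : ∀ k, ∀ a ∈ gA k, f a ∈ gB k
  map_right : ∀ k, ∀ b ∈ gB k, h b ∈ gC k
  comp_zero : ∀ k, ∀ a ∈ gA k, h (f a) = 0
  exact : ∀ k, ∀ b ∈ gB k, h b = 0 → ∃ a ∈ gA k, f a = b
  surj : ∀ k, ∀ c ∈ gC k, ∃ b ∈ gB k, h b = c

end Maps

section LongExact

variable {A B C : Type*} [AddCommGroup A] [Module R A] [AddCommGroup B] [Module R B]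
  [AddCommGroup C] [Module R C] {gA : ℤ → AddSubgroup A} {gB : ℤ → AddSubgroup B}
  {gC : ℤ → AddSubgroup C} {f : A →ₗ[R] B} {h : B →ₗ[R] C} {l : List R}

theorem map_map_eq_zero_of_mem_chains {k : ℤ} (hk : ∀ a ∈ gA k, h (f a) = 0) :
    ∀ (l : List R) (i : ℤ) (c : Chain A l), c ∈ chains gA l i k → map h l (map f l c) = 0
  | [], i, c => by
    obtain ⟨a, hnil⟩ := exists_eq_nil c
    rw [hnil]
    rw [mem_chains_nil, map_nil, map_nil, nil_eq_zero]
    rintro (⟨-, hc⟩ | ⟨-, hc⟩)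
    · exact hk a hc
    · rw [hc, map_zero, map_zero]
  | x :: l, i, c => by
    obtain ⟨a, b, rfl⟩ := exists_eq_cons c
    rw [mem_chains_cons, map_cons, map_cons, cons_eq_zero]
    exact fun hc => ⟨map_map_eq_zero_of_mem_chains hk l i a hc.1,
      map_map_eq_zero_of_mem_chains hk l _ b hc.2⟩

/-- Exactness of the long homology sequence at `H(B)`. -/
theorem GradedExact.vanishes_middle (E : GradedExact gA gB gC f h) (hB : Compatible l gB)
    {i k : ℤ} (vA : HomologyVanishes l gA i k) (vC : HomologyVanishes l gC i k) :
    HomologyVanishes l gB i k := by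
  intro c hc hdc
  obtain ⟨e', he', hde'⟩ := vC (map h l c) (map_mem_chains (E.map_right k) l i c hc)
    (by rw [← map_d, hdc, map_zero])
  obtain ⟨e, he, rfl⟩ := exists_map_eq (E.surj (k - 1)) l (i + 1) e' he'
  have hde : d B l e ∈ chains gB l i k := hB.d_mem he (by ring) (by ring)
  obtain ⟨a, ha, hac⟩ := exists_map_eq_of_map_eq_zero (E.exact k) l i (c - d B l e)
    (sub_mem hc hde) (by rw [map_sub, map_d, hde', sub_self])
  obtain ⟨a', ha', rfl⟩ := vA a ha
    (eq_zero_of_map_eq_zero E.inj l _ (by rw [map_d, hac, map_sub, hdc, d_d, sub_zero]))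
  refine ⟨e + map f l a', add_mem he (map_mem_chains (E.map_left (k - 1)) l _ a' ha'), ?_⟩
  rw [map_add, ← map_d, hac]
  abel

/-- Exactness of the long homology sequence at `H(C)`. -/
theorem GradedExact.vanishes_right (E : GradedExact gA gB gC f h) (hB : Compatible l gB)
    {i k : ℤ} (vB : HomologyVanishes l gB i k) (vA : HomologyVanishes l gA (i - 1) (k + 1)) :
    HomologyVanishes l gC i k := by
  intro c hc hdc
  obtain ⟨b, hb, rfl⟩ := exists_map_eq (E.surj k) l i c hc
  have hdb : d B l b ∈ chains gB l (i - 1) (k + 1) := hB.d_mem hb rfl rfl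
  obtain ⟨a, ha, hab⟩ := exists_map_eq_of_map_eq_zero (E.exact (k + 1)) l _ _ hdb
    (by rw [map_d, hdc])
  obtain ⟨a', ha', rfl⟩ := vA a ha
    (eq_zero_of_map_eq_zero E.inj l _ (by rw [map_d, hab, d_d]))
  rw [sub_add_cancel, add_sub_cancel_right] at ha'
  obtain ⟨e, he, hde⟩ := vB (b - map f l a') (sub_mem hb (map_mem_chains (E.map_left k) l i a' ha'))
    (by rw [map_sub, ← map_d, hab, sub_self])
  refine ⟨map h l e, map_mem_chains (E.map_right (k - 1)) l _ e he, ?_⟩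
  rw [← map_d, hde, map_sub, map_map_eq_zero_of_mem_chains (E.comp_zero k) l i a' ha', sub_zero]

/-- Exactness of the long homology sequence at `H(A)`: the homology of `A` vanishes if that of `C`
does, one homological degree higher, and the map `H(A) → H(B)` is zero. -/
theorem GradedExact.vanishes_left (E : GradedExact gA gB gC f h) (hB : Compatible l gB)
    {i k : ℤ} (vC : HomologyVanishes l gC (i + 1) (k - 1))
    (hAB : ∀ c ∈ chains gA l i k, d A l c = 0 →
      ∃ b ∈ chains gB l (i + 1) (k - 1), d B l b = map f l c) :
    HomologyVanishes l gA i k := by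
  intro a ha hda
  obtain ⟨b, hb, hdb⟩ := hAB a ha hda
  obtain ⟨e', he', hde'⟩ := vC (map h l b) (map_mem_chains (E.map_right _) l _ b hb)
    (by rw [← map_d, hdb, map_map_eq_zero_of_mem_chains (E.comp_zero k) l i a ha])
  obtain ⟨e, he, rfl⟩ := exists_map_eq (E.surj _) l _ e' he'
  have hde : d B l e ∈ chains gB l (i + 1) (k - 1) := hB.d_mem he (by ring) (by ring)
  obtain ⟨a', ha', haa'⟩ := exists_map_eq_of_map_eq_zero (E.exact (k - 1)) l _ (b - d B l e)
    (sub_mem hb hde) (by rw [map_sub, map_d, hde', sub_self])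
  refine ⟨a', ha', sub_eq_zero.1 (eq_zero_of_map_eq_zero E.inj l _ ?_)⟩
  rw [map_sub, map_d, haa', map_sub, d_d, hdb, sub_zero, sub_self]

/-- If `x` is a nonzerodivisor on `B` with quotient `C = B / x B`, then the homology of
`K(x :: l; B)` is that of `K(l; C)`. -/
theorem vanishes_cons_of_quotient {x : R}
    (E : GradedExact (fun k => gB (k - 1)) gB gC (x • LinearMap.id : B →ₗ[R] B) h)
    (hB : Compatible l gB) {i k : ℤ} (vC : HomologyVanishes l gC i k) :
    HomologyVanishes (x :: l) gB i k := by
  intro c hc hd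
  obtain ⟨a, b, rfl⟩ := exists_eq_cons c
  rw [mem_chains_cons] at hc
  rw [d_cons, cons_eq_zero, neg_eq_zero] at hd
  obtain ⟨ha, hb⟩ := hc
  obtain ⟨hda, hdb⟩ := hd
  have hxk : ∀ k, ∀ m ∈ gB (k - 1), h (x • m) = 0 := fun k m hm => E.comp_zero k m hm
  have hxb : map h l (x • b) = 0 := by
    rw [← map_smul_id_apply]
    refine map_map_eq_zero_of_mem_chains (gA := gB) (k := k) (f := x • LinearMap.id) (h := h)
      (fun m hm => ?_) l (i - 1) b hb
    have := hxk (k + 1) m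
    rw [add_sub_cancel_right] at this
    exact this hm
  obtain ⟨e', he', hde'⟩ := vC (map h l a) (map_mem_chains (E.map_right k) l i a ha) (by
    have := congrArg (map h l) hda
    rwa [map_add, hxb, add_zero, map_zero, map_d] at this)
  obtain ⟨e, he, rfl⟩ := exists_map_eq (E.surj _) l _ e' he'
  have hde : d B l e ∈ chains gB l i k := hB.d_mem he (by ring) (by ring)
  obtain ⟨u, hu, hau⟩ := exists_map_eq_of_map_eq_zero (f := x • LinearMap.id) (g := gB)
    (k := k - 1) (E.exact k) l i (a - d B l e)
    (sub_mem ha hde) (by rw [map_sub, map_d, hde', sub_self])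
  rw [map_smul_id_apply] at hau
  refine ⟨Chain.cons e u, mem_chains_cons.2 ⟨he, by rwa [add_sub_cancel_right]⟩, ?_⟩
  rw [d_cons, cons_inj]
  refine ⟨by rw [hau]; abel, ?_⟩
  have h0 : x • (d B l u + b) = 0 := by
    rw [smul_add, ← map_smul, hau, map_sub, d_d, sub_zero, hda]
  rw [← map_smul_id_apply] at h0
  exact neg_eq_of_add_eq_zero_right (eq_zero_of_map_eq_zero E.inj l _ h0)

end LongExact

end Koszul

/-! ### Squarefree monomial ideals -/

namespace SquarefreeIdeal

open MvPolynomial Koszul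

variable {σ : Type*} (K : Type*) [Field K]

/-- The squarefree monomial ideal attached to an upward closed family `N` of sets of variables:
the polynomials all of whose monomials have their support in `N`. -/
def ofUpperSet (N : UpperSet (Set σ)) : Ideal (MvPolynomial σ K) where
  carrier := {p | ∀ m, coeff m p ≠ 0 → (m.support : Set σ) ∈ N}
  zero_mem' m hm := absurd (coeff_zero m) hm
  add_mem' {p q} hp hq m hm := by
    by_cases h : coeff m p = 0
    · exact hq m fun h' => hm (by rw [coeff_add, h, h', add_zero])
    · exact hp m h
  smul_mem' p q hq m hm := by
    classical
    rw [smul_eq_mul, coeff_mul] at hm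
    obtain ⟨⟨a, b⟩, hab, h⟩ := Finset.exists_ne_zero_of_sum_ne_zero hm
    rw [Finset.HasAntidiagonal.mem_antidiagonal] at hab
    refine N.upper ?_ (hq b (right_ne_zero_of_mul h))
    rw [← hab]
    exact Finset.coe_subset.2 (Finsupp.support_mono le_add_self)

variable {K} in
theorem mem_ofUpperSet {N : UpperSet (Set σ)} {p : MvPolynomial σ K} :
    p ∈ ofUpperSet K N ↔ ∀ m, coeff m p ≠ 0 → (m.support : Set σ) ∈ N := Iff.rfl

variable (σ) in
/-- The homogeneous polynomials of degree `k`, for an integer `k`. -/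
def degPart (k : ℤ) : AddSubgroup (MvPolynomial σ K) where
  carrier := {p | ∀ m, coeff m p ≠ 0 → (m.degree : ℤ) = k}
  zero_mem' m hm := absurd (coeff_zero m) hm
  add_mem' {p q} hp hq m hm := by
    by_cases h : coeff m p = 0
    · exact hq m fun h' => hm (by rw [coeff_add, h, h', add_zero])
    · exact hp m h
  neg_mem' {p} hp m hm := hp m fun h => hm (by rw [coeff_neg, h, neg_zero])

variable {K} in
theorem mul_mem_degPart {k k' : ℤ} {p q : MvPolynomial σ K} (hp : p ∈ degPart σ K k)
    (hq : q ∈ degPart σ K k') : p * q ∈ degPart σ K (k + k') := by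
  classical
  intro m hm
  rw [coeff_mul] at hm
  obtain ⟨⟨a, b⟩, hab, h⟩ := Finset.exists_ne_zero_of_sum_ne_zero hm
  rw [Finset.HasAntidiagonal.mem_antidiagonal] at hab
  rw [← hp a (left_ne_zero_of_mul h), ← hq b (right_ne_zero_of_mul h), ← hab]
  simp

variable {K} in
theorem isHomogeneous_mem_degPart {n : ℕ} {p : MvPolynomial σ K} (hp : p.IsHomogeneous n) :
    p ∈ degPart σ K n := by
  intro m hm
  have := hp hm
  rw [show (1 : σ → ℕ) = fun _ => 1 from rfl, ← Finsupp.degree_eq_weight_one] at this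
  exact congrArg _ this

theorem X_mem_degPart (v : σ) : (X v : MvPolynomial σ K) ∈ degPart σ K 1 :=
  isHomogeneous_mem_degPart (isHomogeneous_X K v)

/-- The homogeneous components of the quotient by a squarefree monomial ideal. -/
noncomputable def quotPart (N : UpperSet (Set σ)) (k : ℤ) :
    AddSubgroup (MvPolynomial σ K ⧸ ofUpperSet K N) :=
  (degPart σ K k).map (Submodule.mkQ (ofUpperSet K N)).toAddMonoidHom

variable {K} in
theorem mk_mem_quotPart {N : UpperSet (Set σ)} {k : ℤ} {p : MvPolynomial σ K}
    (hp : p ∈ degPart σ K k) : Submodule.mkQ (ofUpperSet K N) p ∈ quotPart K N k :=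
  ⟨p, hp, rfl⟩

theorem exists_of_mem_quotPart {N : UpperSet (Set σ)} {k : ℤ}
    {c : MvPolynomial σ K ⧸ ofUpperSet K N} (hc : c ∈ quotPart K N k) :
    ∃ p ∈ degPart σ K k, Submodule.mkQ (ofUpperSet K N) p = c := hc

section Maps

variable {K} {N N' : UpperSet (Set σ)} {v : σ}

theorem X_mul_mem_ofUpperSet_iff (h : ∀ S, S ∈ N' ↔ insert v S ∈ N) (p : MvPolynomial σ K) :
    X v * p ∈ ofUpperSet K N ↔ p ∈ ofUpperSet K N' := by
  classical
  have hs : ∀ m : σ →₀ ℕ, ((Finsupp.single v 1 + m).support : Set σ) =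
      insert v (m.support : Set σ) := by
    intro m
    ext w
    by_cases hw : w = v <;> simp [hw, eq_comm]
  constructor
  · intro hp m hm
    rw [h, ← hs]
    exact hp _ (by rwa [coeff_X_mul])
  · intro hp m hm
    rw [coeff_X_mul'] at hm
    split_ifs at hm with hv
    · have := (h _).1 (hp _ hm)
      rw [← hs] at this
      rwa [add_tsub_cancel_of_le] at this
      rw [Finsupp.single_le_iff]
      exact Nat.one_le_iff_ne_zero.2 (Finsupp.mem_support_iff.1 hv)
    · exact absurd rfl hm

/-- Multiplication by the variable `x_v`, as a map `R / (I : x_v) → R / I`. -/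
noncomputable def mulX (h : ∀ S, S ∈ N' ↔ insert v S ∈ N) :
    (MvPolynomial σ K ⧸ ofUpperSet K N') →ₗ[MvPolynomial σ K] MvPolynomial σ K ⧸ ofUpperSet K N :=
  Submodule.mapQ _ _ (LinearMap.lsmul _ _ (X v : MvPolynomial σ K)) fun p hp =>
    (X_mul_mem_ofUpperSet_iff h p).2 hp

theorem mulX_mk (h : ∀ S, S ∈ N' ↔ insert v S ∈ N) (p : MvPolynomial σ K) :
    mulX h (Submodule.mkQ (ofUpperSet K N') p) = Submodule.mkQ (ofUpperSet K N) (X v * p) := rfl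

theorem mulX_self (h : ∀ S, S ∈ N ↔ insert v S ∈ N) :
    mulX h = ((X v : MvPolynomial σ K) • LinearMap.id :
    (MvPolynomial σ K ⧸ ofUpperSet K N) →ₗ[MvPolynomial σ K] _) := by
  refine LinearMap.ext fun a => ?_
  obtain ⟨p, rfl⟩ := Submodule.mkQ_surjective _ a
  rw [mulX_mk, ← smul_eq_mul, map_smul, LinearMap.smul_apply, LinearMap.id_apply]

/-- The quotient map `R / I → R / (I + (x_v))`. -/
noncomputable def quotX (h : ∀ S, S ∈ N' ↔ S ∈ N ∨ v ∈ S) :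
    (MvPolynomial σ K ⧸ ofUpperSet K N) →ₗ[MvPolynomial σ K] MvPolynomial σ K ⧸ ofUpperSet K N' :=
  Submodule.mapQ _ _ LinearMap.id fun _ hp m hm => (h _).2 (.inl (hp m hm))

theorem quotX_mk (h : ∀ S, S ∈ N' ↔ S ∈ N ∨ v ∈ S) (p : MvPolynomial σ K) :
    quotX h (Submodule.mkQ (ofUpperSet K N) p) = Submodule.mkQ (ofUpperSet K N') p := rfl

theorem mkQ_eq_zero {p : MvPolynomial σ K} :
    Submodule.mkQ (ofUpperSet K N) p = 0 ↔ p ∈ ofUpperSet K N :=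
  (Submodule.Quotient.mk_eq_zero _)

/-- The exact sequence `0 → (R / (I : x_v))(-1) → R / I → R / (I + (x_v)) → 0`. -/
theorem gradedExact {N'' : UpperSet (Set σ)} (hcolon : ∀ S, S ∈ N' ↔ insert v S ∈ N)
    (hadd : ∀ S, S ∈ N'' ↔ S ∈ N ∨ v ∈ S) :
    GradedExact (fun k => quotPart K N' (k - 1)) (quotPart K N) (quotPart K N'')
      (mulX hcolon) (quotX hadd) where
  inj a ha := by
    obtain ⟨p, rfl⟩ := Submodule.mkQ_surjective _ a
    rw [mulX_mk, mkQ_eq_zero, X_mul_mem_ofUpperSet_iff hcolon] at ha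
    exact mkQ_eq_zero.2 ha
  map_left k a ha := by
    obtain ⟨p, hp, rfl⟩ := exists_of_mem_quotPart K ha
    rw [mulX_mk]
    have := mul_mem_degPart (X_mem_degPart K v) hp
    rw [add_sub_cancel] at this
    exact mk_mem_quotPart this
  map_right k b hb := by
    obtain ⟨p, hp, rfl⟩ := exists_of_mem_quotPart K hb
    exact mk_mem_quotPart hp
  comp_zero k a ha := by
    obtain ⟨p, hp, rfl⟩ := exists_of_mem_quotPart K ha
    rw [mulX_mk, quotX_mk, mkQ_eq_zero]
    classical
    intro m hm
    rw [coeff_X_mul'] at hm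
    split_ifs at hm with hv
    · exact (hadd _).2 (.inr hv)
    · exact absurd rfl hm
  exact k b hb hb0 := by
    classical
    obtain ⟨p, hp, rfl⟩ := exists_of_mem_quotPart K hb
    rw [quotX_mk, mkQ_eq_zero] at hb0
    -- the monomials of `p` that are divisible by `x_v` form `x_v q`; the others lie in `I`
    refine ⟨Submodule.mkQ _ (p.divMonomial (Finsupp.single v 1)), mk_mem_quotPart ?_, ?_⟩
    · intro m hm
      rw [coeff_divMonomial] at hm
      have := hp _ hm
      rw [map_add, Finsupp.degree_single] at this
      push_cast at this
      linarith
    · rw [mulX_mk, eq_comm, ← sub_eq_zero, ← map_sub, mkQ_eq_zero]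
      have hmod := divMonomial_add_modMonomial_single p v
      rw [sub_eq_iff_eq_add'.2 hmod.symm]
      intro m hm
      by_cases hv : Finsupp.single v 1 ≤ m
      · exact absurd (coeff_modMonomial_of_le p hv) hm
      · rw [coeff_modMonomial_of_not_le p hv] at hm
        refine ((hadd _).1 (hb0 m hm)).resolve_right fun h => hv ?_
        rw [Finsupp.single_le_iff]
        exact Nat.one_le_iff_ne_zero.2 (Finsupp.mem_support_iff.1 h)
  surj k c hc := by
    obtain ⟨p, hp, rfl⟩ := exists_of_mem_quotPart K hc
    exact ⟨_, mk_mem_quotPart hp, quotX_mk hadd p⟩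

theorem compatible_degPart (l : List σ) :
    Compatible (l.map (X : σ → MvPolynomial σ K)) (degPart σ K) := by
  intro x hx k p hp
  obtain ⟨v, -, rfl⟩ := List.mem_map.1 hx
  rw [add_comm]
  exact mul_mem_degPart (X_mem_degPart K v) hp

theorem compatible_quotPart (l : List σ) (N : UpperSet (Set σ)) :
    Compatible (l.map (X : σ → MvPolynomial σ K)) (quotPart K N) := by
  intro x hx k c hc
  obtain ⟨p, hp, rfl⟩ := exists_of_mem_quotPart K hc
  rw [← map_smul]
  exact mk_mem_quotPart (compatible_degPart l x hx k p hp)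

end Maps

/-- The Koszul complex of distinct variables `l` on the polynomial ring in the variables `l`, given
as the quotient of the polynomial ring by the other variables, is acyclic outside
bidegree `(0, 0)`. -/
theorem vanishes_list : ∀ (l : List σ) (_ : l.Nodup) (N : UpperSet (Set σ))
    (_ : ∀ S, S ∈ N ↔ ∃ v ∈ S, v ∉ l) (i k : ℤ) (_ : i ≠ 0 ∨ k ≠ 0),
    HomologyVanishes (l.map (X : σ → MvPolynomial σ K)) (quotPart K N) i k
  | [], _, N, hN, i, k, hik => by
    intro c hc _
    obtain ⟨q, hq⟩ := exists_eq_nil c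
    refine ⟨0, zero_mem _, ?_⟩
    rw [map_zero, eq_comm, hq, nil_eq_zero]
    change c ∈ chains _ [] i k at hc
    rw [hq, mem_chains_nil] at hc
    obtain ⟨hi, hq⟩ | ⟨-, hq⟩ := hc
    · obtain ⟨p, hp, rfl⟩ := exists_of_mem_quotPart K hq
      rw [mkQ_eq_zero]
      intro m hm
      rw [hN]
      have hk := hp m hm
      have hm0 : m ≠ 0 := by
        rintro rfl
        exact hik.resolve_left (fun h => h hi) (by rw [← hk]; simp)
      obtain ⟨v, hv⟩ := Finsupp.support_nonempty_iff.2 hm0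
      exact ⟨v, hv, by simp⟩
    · exact hq
  | v :: l, hl, N, hN, i, k, hik => by
    rw [List.nodup_cons] at hl
    let N' : UpperSet (Set σ) := ⟨{S | S ∈ N ∨ v ∈ S}, fun S T hST hS =>
      hS.imp (fun h => N.upper hST h) fun h => hST h⟩
    have hadd : ∀ S, S ∈ N' ↔ S ∈ N ∨ v ∈ S := fun S => Iff.rfl
    have hcolon : ∀ S, S ∈ N ↔ insert v S ∈ N := fun S => by
      rw [hN, hN]
      constructor
      · rintro ⟨w, hw, hwl⟩
        exact ⟨w, Set.mem_insert_of_mem v hw, hwl⟩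
      · rintro ⟨w, rfl | hw, hwl⟩
        · exact absurd List.mem_cons_self hwl
        · exact ⟨w, hw, hwl⟩
    have E := gradedExact (K := K) hcolon hadd
    rw [mulX_self] at E
    refine vanishes_cons_of_quotient E (compatible_quotPart l N)
      (vanishes_list l hl.2 N' (fun S => ?_) i k hik)
    rw [hadd, hN]
    constructor
    · rintro (⟨w, hw, hwl⟩ | hv)
      · exact ⟨w, hw, fun h => hwl (List.mem_cons_of_mem v h)⟩
      · exact ⟨v, hv, hl.1⟩
    · rintro ⟨w, hw, hwl⟩
      by_cases hwv : w = v
      · exact .inr (hwv ▸ hw)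
      · exact .inl ⟨w, hw, by simp [hwv, hwl]⟩

variable [Fintype σ]

variable (σ) in
/-- The list of all variables. -/
noncomputable def vars : List (MvPolynomial σ K) := (Finset.univ : Finset σ).toList.map X

/-- The polynomial ring is acyclic for the Koszul complex of all variables, outside
bidegree `(0, 0)`. -/
theorem vanishes_polynomial {i k : ℤ} (hik : i ≠ 0 ∨ k ≠ 0) :
    HomologyVanishes (vars σ K) (degPart σ K) i k := by
  have h := vanishes_list K (Finset.univ : Finset σ).toList (Finset.nodup_toList _)
    ⊤ (by simp) i k hik
  change HomologyVanishes (vars σ K) _ _ _ at h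
  have hinj : ∀ p : MvPolynomial σ K, Submodule.mkQ (ofUpperSet K ⊤) p = 0 → p = 0 := by
    intro p hp
    rw [mkQ_eq_zero] at hp
    ext m
    rw [coeff_zero]
    by_contra hm
    exact UpperSet.notMem_top (hp m hm)
  intro c hc hdc
  obtain ⟨b, hb, hbc⟩ := h (map (Submodule.mkQ _) _ c)
    (map_mem_chains (fun m hm => mk_mem_quotPart hm) _ _ c hc)
    (by rw [← map_d, hdc, map_zero])
  obtain ⟨e, he, rfl⟩ := exists_map_eq (g := degPart σ K) (k := k - 1)
    (fun n hn => exists_of_mem_quotPart K hn) _ _ b hb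
  refine ⟨e, he, sub_eq_zero.1 (eq_zero_of_map_eq_zero hinj (vars σ K) _ ?_)⟩
  rw [map_sub, map_d, hbc, sub_self]

/-- The Koszul homology of `R / I` vanishes in all bidegrees `(i, j)` with `j - i > r`; that is,
the Castelnuovo-Mumford regularity of `R / I` is at most `r`. -/
def RegularityLE (N : UpperSet (Set σ)) (r : ℤ) : Prop :=
  ∀ i k, r < k → HomologyVanishes (vars σ K) (quotPart K N) i k

variable {K}

theorem regularityLE_of_forall_mem {N : UpperSet (Set σ)} (hN : ∀ S, S ∈ N) (r : ℤ) :
    RegularityLE K N r := by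
  intro i k _ c _ _
  refine ⟨0, zero_mem _, ?_⟩
  rw [map_zero, eq_comm]
  refine eq_zero_of_map_eq_zero (f := (0 : _ →ₗ[MvPolynomial σ K] MvPolynomial σ K))
    (fun q _ => ?_) _ c (map_zero_apply _ c)
  obtain ⟨p, rfl⟩ := Submodule.mkQ_surjective _ q
  exact mkQ_eq_zero.2 fun m _ => hN _

theorem regularityLE_of_forall_notMem {N : UpperSet (Set σ)} (hN : ∀ S, S ∉ N) {r : ℤ}
    (hr : 0 ≤ r) : RegularityLE K N r := fun i k hk =>
  vanishes_list K _ (Finset.nodup_toList _) N (fun S => by simp [hN]) i k (.inr (by omega))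

/-- If `I = I_Δ` then `I : x_v` comes from the link of `v` and `I + (x_v)` is obtained by adding the
variable `x_v` to the ideal coming from the deletion of `v`. -/
theorem regularityLE_of_link_of_deletion {N Nl Nd : UpperSet (Set σ)} {v : σ} {r : ℤ}
    (hl : ∀ S, S ∈ Nl ↔ insert v S ∈ N) (hd : ∀ S, S ∈ Nd ↔ S \ {v} ∈ N)
    (hlink : RegularityLE K Nl (r - 1)) (hdel : RegularityLE K Nd r) : RegularityLE K N r := by
  let N' : UpperSet (Set σ) := ⟨{S | S ∈ N ∨ v ∈ S}, fun S T hST hS =>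
      hS.imp (fun h => N.upper hST h) fun h => hST h⟩
  have hcolon : ∀ S, S ∈ Nd ↔ insert v S ∈ Nd := fun S => by
    rw [hd, hd, Set.insert_sdiff_of_mem _ (Set.mem_singleton v)]
  have hN' : ∀ S, S ∈ N' ↔ S ∈ N ∨ v ∈ S := fun S => Iff.rfl
  have hadd : ∀ S, S ∈ N' ↔ S ∈ Nd ∨ v ∈ S := fun S => by
    by_cases hv : v ∈ S
    · simp [hv, hN']
    · simp [hv, hN', hd]
  have hquot : ∀ i k, r < k → HomologyVanishes (vars σ K) (quotPart K N') i k := fun i k hk =>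
    (gradedExact hcolon hadd).vanishes_right (compatible_quotPart _ _) (hdel i k hk) 
      (homologyVanishes_shift.2 (by rw [add_sub_cancel_right]; exact hdel (i - 1) k hk))
  intro i k hk
  exact (gradedExact hl hN').vanishes_middle (compatible_quotPart _ _)
    (homologyVanishes_shift.2 (hlink i (k - 1) (by omega))) (hquot i k hk)

end SquarefreeIdeal

/-! ### Degrees in a minimal free resolution -/

namespace SquarefreeIdeal

open MvPolynomial Koszul

set_option linter.unusedSectionVars false

section Free

variable {σ K : Type*} [Field K]

/-- The component of degree `k` of a polynomial, for an integer `k`. -/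
noncomputable def intComponent (k : ℤ) : MvPolynomial σ K →ₗ[K] MvPolynomial σ K :=
  if 0 ≤ k then homogeneousComponent k.toNat else 0

theorem coeff_intComponent (k : ℤ) (m : σ →₀ ℕ) (p : MvPolynomial σ K) :
    coeff m (intComponent k p) = if (m.degree : ℤ) = k then coeff m p else 0 := by
  unfold intComponent
  by_cases hk : 0 ≤ k
  · rw [if_pos hk, coeff_homogeneousComponent]
    exact if_congr (by omega) rfl rfl
  · rw [if_neg hk, if_neg (by omega), LinearMap.zero_apply, coeff_zero]

theorem intComponent_mem (k : ℤ) (p : MvPolynomial σ K) : intComponent k p ∈ degPart σ K k := by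
  intro m hm
  rw [coeff_intComponent] at hm
  by_contra h
  exact hm (if_neg h)

theorem intComponent_eq_self {k : ℤ} {p : MvPolynomial σ K} (hp : p ∈ degPart σ K k) :
    intComponent k p = p := by
  ext m
  rw [coeff_intComponent]
  split_ifs with h
  · rfl
  · by_contra h'
    exact h (hp m (Ne.symm h'))

theorem intComponent_mul {k e : ℤ} (p : MvPolynomial σ K) {q : MvPolynomial σ K}
    (hq : q ∈ degPart σ K e) : intComponent k (p * q) = intComponent (k - e) p * q := by
  classical
  ext m
  rw [coeff_intComponent, coeff_mul, coeff_mul, Finset.ite_sum_zero]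
  refine Finset.sum_congr rfl fun x hx => ?_
  rw [Finset.HasAntidiagonal.mem_antidiagonal] at hx
  rw [coeff_intComponent]
  by_cases hx2 : coeff x.2 q = 0
  · simp [hx2]
  · have h2 := hq _ hx2
    have h1 : (m.degree : ℤ) = x.1.degree + x.2.degree := by rw [← hx]; simp
    by_cases hm : (m.degree : ℤ) = k
    · rw [if_pos hm, if_pos (by omega)]
    · rw [if_neg hm, if_neg (by omega), zero_mul]

theorem intComponent_mem_ofUpperSet {N : UpperSet (Set σ)} {p : MvPolynomial σ K}
    (hp : p ∈ ofUpperSet K N) (k : ℤ) : intComponent k p ∈ ofUpperSet K N := by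
  intro m hm
  rw [coeff_intComponent] at hm
  split_ifs at hm
  · exact hp m hm
  · exact absurd rfl hm

/-- The homogeneous components of the graded free module `⨁ a, R(-deg a)`. -/
def freePart {n : ℕ} (deg : Fin n → ℕ) (k : ℤ) : AddSubgroup (Fin n → MvPolynomial σ K) where
  carrier := {f | ∀ a, f a ∈ degPart σ K (k - deg a)}
  zero_mem' _ := zero_mem _
  add_mem' hf hg a := add_mem (hf a) (hg a)
  neg_mem' hf a := neg_mem (hf a)

/-- The component of degree `k` of an element of the graded free module `⨁ a, R(-deg a)`. -/
noncomputable def freeComponent {n : ℕ} (deg : Fin n → ℕ) (k : ℤ)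
    (f : Fin n → MvPolynomial σ K) : Fin n → MvPolynomial σ K :=
  fun a => intComponent (k - deg a) (f a)

theorem freeComponent_mem {n : ℕ} (deg : Fin n → ℕ) (k : ℤ) (f : Fin n → MvPolynomial σ K) :
    freeComponent deg k f ∈ freePart deg k := fun a => intComponent_mem _ (f a)

theorem freeComponent_eq_self {n : ℕ} {deg : Fin n → ℕ} {k : ℤ} {f : Fin n → MvPolynomial σ K}
    (hf : f ∈ freePart deg k) : freeComponent deg k f = f :=
  funext fun a => intComponent_eq_self (hf a)

theorem single_mem_freePart {n : ℕ} (deg : Fin n → ℕ) (a : Fin n) :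
    (Pi.single a 1 : Fin n → MvPolynomial σ K) ∈ freePart deg (deg a) := by
  intro b
  by_cases hb : b = a
  · subst hb
    rw [Pi.single_eq_same, sub_self]
    exact isHomogeneous_mem_degPart (isHomogeneous_one σ K)
  · rw [Pi.single_eq_of_ne hb]
    exact zero_mem _

theorem apply_eq_sum {n : ℕ} {M : Type*} [AddCommGroup M] [Module (MvPolynomial σ K) M]
    (D : (Fin n → MvPolynomial σ K) →ₗ[MvPolynomial σ K] M) (f : Fin n → MvPolynomial σ K) :
    D f = ∑ b, f b • D (Pi.single b 1) := by
  conv_lhs => rw [pi_eq_sum_univ' f]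
  simp [map_sum]

/-- A homogeneous map between graded free modules commutes with taking components. -/
theorem freeComponent_apply {n n' : ℕ} {deg : Fin n → ℕ} {deg' : Fin n' → ℕ}
    {D : (Fin n → MvPolynomial σ K) →ₗ[MvPolynomial σ K] (Fin n' → MvPolynomial σ K)}
    (hD : ∀ b a, D (Pi.single b 1) a ∈ degPart σ K ((deg b : ℤ) - deg' a)) (k : ℤ)
    (f : Fin n → MvPolynomial σ K) :
    freeComponent deg' k (D f) = D (freeComponent deg k f) := by
  funext a
  rw [apply_eq_sum D f, apply_eq_sum D (freeComponent deg k f)]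
  simp only [freeComponent, Finset.sum_apply, Pi.smul_apply, smul_eq_mul, map_sum]
  refine Finset.sum_congr rfl fun b _ => ?_
  rw [intComponent_mul _ (hD b a), sub_sub_sub_cancel_right]

variable [Fintype σ]

theorem compatible_freePart {n : ℕ} (deg : Fin n → ℕ) :
    Compatible (vars σ K) (freePart (σ := σ) (K := K) deg) := by
  intro x hx k f hf a
  rw [add_sub_right_comm]
  exact compatible_degPart _ x hx _ _ (hf a)

/-- A Koszul cycle over the polynomial ring is a boundary, unless it has homological degree `0`
and is not in the ideal of the variables. -/
theorem exists_d_eq_of_polynomial {i k : ℤ} {c : Chain (MvPolynomial σ K) (vars σ K)}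
    (hc : c ∈ chains (degPart σ K) (vars σ K) i k) (hdc : d _ (vars σ K) c = 0)
    (h0 : i = 0 → constantCoeff (toCoeff (vars σ K) c) = 0) :
    ∃ b ∈ chains (degPart σ K) (vars σ K) (i + 1) (k - 1), d _ (vars σ K) b = c := by
  by_cases hik : i ≠ 0 ∨ k ≠ 0
  · exact vanishes_polynomial K hik c hc hdc
  · push Not at hik
    obtain ⟨rfl, rfl⟩ := hik
    obtain ⟨hp, hcp⟩ := eq_ofCoeff_of_mem_chains _ c hc
    have hp0 : toCoeff (vars σ K) c = 0 := by
      ext m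
      rw [coeff_zero]
      by_contra hm
      have hm0 : m = 0 := by
        have := hp m hm
        rwa [Nat.cast_eq_zero, Finsupp.degree_eq_zero_iff] at this
      rw [hm0] at hm
      exact hm (h0 rfl)
    exact ⟨0, zero_mem _, by rw [hcp, hp0, map_zero, map_zero]⟩

theorem exists_d_eq_of_free {n : ℕ} {deg : Fin n → ℕ} {i k : ℤ}
    {c : Chain (Fin n → MvPolynomial σ K) (vars σ K)}
    (hc : c ∈ chains (freePart deg) (vars σ K) i k) (hdc : d _ (vars σ K) c = 0)
    (h0 : i = 0 → ∀ a, constantCoeff (toCoeff (vars σ K) c a) = 0) :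
    ∃ b ∈ chains (freePart deg) (vars σ K) (i + 1) (k - 1), d _ (vars σ K) b = c := by
  have key : ∀ a, ∃ b ∈ chains (degPart σ K) (vars σ K) (i + 1) (k - deg a - 1),
      d _ (vars σ K) b = Koszul.map (LinearMap.proj a) (vars σ K) c := fun a => by
    refine exists_d_eq_of_polynomial ?_ ?_ fun hi => ?_
    · exact map_mem_chains (g := freePart deg) (fun f hf => hf a) _ _ c hc
    · rw [← map_d, hdc, map_zero]
    · rw [toCoeff_map]
      exact h0 hi a
  choose b hb hdb using key
  refine ⟨∑ a, Koszul.map (LinearMap.single (MvPolynomial σ K) (fun _ => MvPolynomial σ K) a)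
    (vars σ K) (b a), sum_mem fun a _ => ?_, ?_⟩
  · refine map_mem_chains (fun p hp a' => ?_) _ _ (b a) (hb a)
    rw [LinearMap.single_apply]
    by_cases ha : a' = a
    · subst ha
      rw [Pi.single_eq_same]
      rwa [sub_right_comm] at hp
    · rw [Pi.single_eq_of_ne ha]
      exact zero_mem _
  · rw [map_sum]
    simp_rw [← map_d, hdb, Koszul.map_map]
    rw [← map_sum_apply]
    convert Koszul.map_id _ c
    refine LinearMap.ext fun f => ?_
    simpa [LinearMap.sum_apply] using Finset.univ_sum_single f

end Free

section Resolution

variable {σ K : Type*} [Field K] [Fintype σ] {N : UpperSet (Set σ)}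

/-- The kernel of the map out of the `i`-th module of a resolution. -/
noncomputable def cycles (F : MinimalGradedFreeResolution σ K (MvPolynomial σ K ⧸ ofUpperSet K N)
    (quotientGrading (ofUpperSet K N))) :
    ∀ i, Submodule (MvPolynomial σ K) (Fin (F.rank i) → MvPolynomial σ K)
  | 0 => LinearMap.ker F.aug
  | i + 1 => LinearMap.ker (F.d i)

/-- The homogeneous components of the `(i + 1)`-st syzygy module, as subgroups of the `i`-th module
of a resolution. -/
noncomputable def syzygyPart
    (F : MinimalGradedFreeResolution σ K (MvPolynomial σ K ⧸ ofUpperSet K N)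
    (quotientGrading (ofUpperSet K N))) (i : ℕ) (k : ℤ) :
    AddSubgroup (Fin (F.rank i) → MvPolynomial σ K) :=
  freePart (F.deg i) k ⊓ (cycles F i).toAddSubgroup

variable (F : MinimalGradedFreeResolution σ K (MvPolynomial σ K ⧸ ofUpperSet K N)
    (quotientGrading (ofUpperSet K N)))

theorem mem_cycles_iff (i : ℕ) (f : Fin (F.rank i) → MvPolynomial σ K) :
    f ∈ cycles F i ↔ ∃ e, F.d i e = f := by
  cases i with
  | zero => exact F.exact_zero f
  | succ i => exact F.exact_succ i f

/-- By minimality, the entries of a syzygy lie in the ideal of the variables. -/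
theorem constantCoeff_of_mem_cycles {i : ℕ} {f : Fin (F.rank i) → MvPolynomial σ K}
    (hf : f ∈ cycles F i) (a : Fin (F.rank i)) : constantCoeff (f a) = 0 := by
  obtain ⟨e, rfl⟩ := (mem_cycles_iff F i f).1 hf
  rw [apply_eq_sum]
  simp [Finset.sum_apply, F.minimal]

theorem d_single_mem (i : ℕ) (b : Fin (F.rank (i + 1))) (a : Fin (F.rank i)) :
    F.d i (Pi.single b 1) a ∈ degPart σ K ((F.deg (i + 1) b : ℤ) - F.deg i a) := by
  obtain h | ⟨m, hm, h⟩ := F.d_homogeneous i b a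
  · rw [h]; exact zero_mem _
  · rw [hm]
    push_cast
    rw [add_sub_cancel_left]
    exact isHomogeneous_mem_degPart h

theorem exists_aug_single (a : Fin (F.rank 0)) : ∃ q ∈ degPart σ K (F.deg 0 a),
    F.aug (Pi.single a 1) = Submodule.mkQ (ofUpperSet K N) q := by
  obtain ⟨q, hq, h⟩ := F.aug_homogeneous a
  exact ⟨q, isHomogeneous_mem_degPart hq, h.symm⟩

theorem gradedExact_aug : GradedExact (syzygyPart F 0) (freePart (F.deg 0)) (quotPart K N)
    LinearMap.id F.aug where
  inj _ h := h
  map_left _ _ h := h.1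
  comp_zero _ _ h := h.2
  exact _ b hb h := ⟨b, ⟨hb, h⟩, rfl⟩
  map_right k f hf := by
    rw [apply_eq_sum]
    refine sum_mem fun a _ => ?_
    obtain ⟨q, hq, h⟩ := exists_aug_single F a
    rw [h, ← map_smul]
    have := mul_mem_degPart (hf a) hq
    rw [sub_add_cancel] at this
    exact mk_mem_quotPart this
  surj k c hc := by
    obtain ⟨p, hp, rfl⟩ := exists_of_mem_quotPart K hc
    obtain ⟨f, hf⟩ := F.aug_surjective (Submodule.mkQ (ofUpperSet K N) p)
    choose q hq h using exists_aug_single F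
    refine ⟨freeComponent (F.deg 0) k f, freeComponent_mem _ _ _, ?_⟩
    rw [apply_eq_sum] at hf ⊢
    simp_rw [h, ← map_smul, ← map_sum] at hf ⊢
    rw [← sub_eq_zero, ← map_sub, mkQ_eq_zero] at hf ⊢
    have := intComponent_mem_ofUpperSet hf k
    rw [map_sub, intComponent_eq_self hp, map_sum] at this
    simpa only [smul_eq_mul, intComponent_mul _ (hq _), freeComponent] using this

theorem gradedExact_d (i : ℕ) : GradedExact (syzygyPart F (i + 1)) (freePart (F.deg (i + 1)))
    (syzygyPart F i) LinearMap.id (F.d i) where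
  inj _ h := h
  map_left _ _ h := h.1
  comp_zero _ _ h := h.2
  exact _ b hb h := ⟨b, ⟨hb, h⟩, rfl⟩
  map_right k f hf := by
    refine ⟨?_, (mem_cycles_iff F i _).2 ⟨f, rfl⟩⟩
    rw [← freeComponent_eq_self hf, ← freeComponent_apply (d_single_mem F i)]
    exact freeComponent_mem _ _ _
  surj k c hc := by
    obtain ⟨e, rfl⟩ := (mem_cycles_iff F i c).1 hc.2
    refine ⟨freeComponent (F.deg (i + 1)) k e, freeComponent_mem _ _ _, ?_⟩
    rw [← freeComponent_apply (d_single_mem F i), freeComponent_eq_self hc.1]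

/-- Dimension shifting along `0 → Z → F → C → 0` with `F` free: the Koszul homology of the syzygies
`Z` vanishes where that of `C` does, one homological degree higher. In homological degree `0` this
uses that `Z` is contained in the ideal of the variables times `F`. -/
theorem vanishes_syzygy {i : ℕ} {C : Type*} [AddCommGroup C] [Module (MvPolynomial σ K) C]
    {gC : ℤ → AddSubgroup C} {h : (Fin (F.rank i) → MvPolynomial σ K) →ₗ[MvPolynomial σ K] C}
    (E : GradedExact (syzygyPart F i) (freePart (F.deg i)) gC LinearMap.id h) {s k : ℤ}
    (vC : HomologyVanishes (vars σ K) gC (s + 1) (k - 1)) :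
    HomologyVanishes (vars σ K) (syzygyPart F i) s k := by
  refine E.vanishes_left (compatible_freePart _) vC fun c hc hdc => ?_
  rw [Koszul.map_id]
  refine exists_d_eq_of_free ?_ hdc fun hs a => ?_
  · rw [← Koszul.map_id _ c]
    exact map_mem_chains (E.map_left k) _ _ c hc
  · subst hs
    exact constantCoeff_of_mem_cycles F (eq_ofCoeff_of_mem_chains _ c hc).1.2 a

/-- A module without Koszul homology in bidegree `(0, k)` has no minimal generator of
degree `k`. -/
theorem deg_ne_of_vanishes {i : ℕ} {C : Type*} [AddCommGroup C] [Module (MvPolynomial σ K) C]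
    {gC : ℤ → AddSubgroup C} {h : (Fin (F.rank i) → MvPolynomial σ K) →ₗ[MvPolynomial σ K] C}
    (E : GradedExact (syzygyPart F i) (freePart (F.deg i)) gC LinearMap.id h) {k : ℤ}
    (vC : HomologyVanishes (vars σ K) gC 0 k) (a : Fin (F.rank i)) : (F.deg i a : ℤ) ≠ k := by
  rintro rfl
  have he := single_mem_freePart (σ := σ) (K := K) (F.deg i) a
  set e : Fin (F.rank i) → MvPolynomial σ K := Pi.single a 1 with hedef
  obtain ⟨b', hb', hdb'⟩ := vC (ofCoeff _ (h e))
    (ofCoeff_mem_chains (E.map_right _ e he) _) (d_ofCoeff _ _)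
  obtain ⟨b, hb, rfl⟩ := exists_map_eq (E.surj _) _ _ b' hb'
  have hdb := (compatible_freePart (F.deg i)).d_mem (i' := 0) (k' := F.deg i a) hb
    (by ring) (by ring)
  have hker : h (e - toCoeff _ (d _ (vars σ K) b)) = 0 := by
    rw [map_sub, ← toCoeff_map, map_d, hdb', toCoeff_ofCoeff, sub_self]
  obtain ⟨z, hz, hze⟩ := E.exact _ _
    (sub_mem he (eq_ofCoeff_of_mem_chains _ _ hdb).1) hker
  have h1 := constantCoeff_of_mem_cycles F hz.2 a
  rw [LinearMap.id_apply] at hze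
  have h2 := apply_toCoeff_d ((constantCoeff : MvPolynomial σ K →+* K).toAddMonoidHom.comp
    (Pi.evalAddMonoidHom (fun _ : Fin (F.rank i) => MvPolynomial σ K) a)) (vars σ K)
    (fun x hx m => by
      obtain ⟨v, -, rfl⟩ := List.mem_map.1 hx
      simp) b
  rw [hze, Pi.sub_apply, map_sub, hedef, Pi.single_eq_same] at h1
  have h3 : constantCoeff (toCoeff (vars σ K) (d _ (vars σ K) b) a) = 0 := h2
  rw [h3, sub_zero, map_one] at h1
  exact one_ne_zero h1

theorem vanishes_syzygyPart (i : ℕ) {s k : ℤ}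
    (h : HomologyVanishes (vars σ K) (quotPart K N) (s + i + 1) (k - i - 1)) :
    HomologyVanishes (vars σ K) (syzygyPart F i) s k := by
  induction i generalizing s k with
  | zero => exact vanishes_syzygy F (gradedExact_aug F) (by simpa using h)
  | succ i ih =>
    refine vanishes_syzygy F (gradedExact_d F i) (ih ?_)
    convert h using 1 <;> push_cast <;> ring

theorem deg_sub_le {r : ℤ} (hN : RegularityLE K N r) (i : ℕ) (a : Fin (F.rank i)) :
    (F.deg i a : ℤ) - i ≤ r := by
  by_contra! hr
  cases i with
  | zero =>
    exact deg_ne_of_vanishes F (gradedExact_aug F) (hN 0 _ hr) a (by simp)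
  | succ i =>
    refine deg_ne_of_vanishes F (gradedExact_d F i) (k := F.deg (i + 1) a)
      (vanishes_syzygyPart F i (hN _ _ ?_)) a rfl
    push_cast at hr
    omega

variable (K) in
theorem regularity_le {r : ℤ} (hN : RegularityLE K N r) :
    regularity σ K (quotientGrading (ofUpperSet K N)) ≤ ((r : ℝ) : EReal) := by
  refine iSup_le fun i => iSup_le fun j => iSup_le fun hij => ?_
  obtain ⟨F, hF⟩ : ∃ F : MinimalGradedFreeResolution σ K (MvPolynomial σ K ⧸ ofUpperSet K N)
      (quotientGrading (ofUpperSet K N)),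
      ((Finset.univ.filter fun a => F.deg i a = j).card : ℕ∞) ≠ 0 := by
    by_contra! h
    exact hij (by simpa [gradedBetti] using h)
  rw [Nat.cast_ne_zero, Finset.card_ne_zero] at hF
  obtain ⟨a, ha⟩ := hF
  have := deg_sub_le F hN i a
  rw [(Finset.mem_filter.1 ha).2] at this
  exact_mod_cast this

end Resolution

end SquarefreeIdeal

/-! ### Complexes and their minimal nonfaces -/

namespace VertexComplex

variable {α : Type*}

/-- The hypergraph of the minimal nonfaces of a complex. -/
def clutter (Δ : VertexComplex α) : Hypergraph α where
  vertexSet := Δ.vertices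
  edgeSet := {e | e ⊆ Δ.vertices ∧ e ∉ Δ.faces ∧ ∀ f, f ⊂ e → f ∈ Δ.faces}
  subset_vertexSet_of_mem_edgeSet' _ he := he.1

variable {Δ : VertexComplex α}

theorem clutter_isSimple : Δ.clutter.IsSimple := fun e he f hf hef => by
  by_contra hne
  exact he.2.1 (hf.2.2 e (hef.ssubset_of_ne hne))

theorem notMem_faces_of_subset {e S : Set α} (he : e ∈ Δ.clutter.edgeSet) (heS : e ⊆ S) :
    S ∉ Δ.faces := fun hS => he.2.1 (Δ.down_closed S hS e heS)

theorem exists_edge_subset (hfin : Δ.vertices.Finite) {S : Set α} (hS : S ⊆ Δ.vertices)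
    (hnf : S ∉ Δ.faces) : ∃ e ∈ Δ.clutter.edgeSet, e ⊆ S := by
  have hs : {T : Set α | T ⊆ S ∧ T ∉ Δ.faces}.Finite :=
    (hfin.subset hS).finite_subsets.subset fun T hT => hT.1
  obtain ⟨e, heS, he⟩ := hs.exists_le_minimal (a := S) ⟨subset_rfl, hnf⟩
  refine ⟨e, ⟨heS.trans hS, he.prop.2, fun f hf => ?_⟩, heS⟩
  by_contra hff
  exact hf.2 (he.le_of_le ⟨hf.1.trans heS, hff⟩ hf.1)

theorem exists_facet_superset (hfin : Δ.vertices.Finite) {F : Set α} (hF : F ∈ Δ.faces) :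
    ∃ A ∈ Δ.facets, F ⊆ A := by
  have hs : Δ.faces.Finite := hfin.finite_subsets.subset fun T hT => Δ.subset_vertices T hT
  obtain ⟨A, hFA, hA⟩ := hs.exists_le_maximal hF
  exact ⟨A, ⟨hA.prop, fun G hG hAG => (hA.eq_of_le hG hAG).symm⟩, hFA⟩

theorem mem_clutter_deletion {x : α} {e : Set α} :
    e ∈ (Δ.deletion x).clutter.edgeSet ↔ e ∈ Δ.clutter.edgeSet ∧ x ∉ e := by
  constructor
  · rintro ⟨h1, h2, h3⟩
    have hx : x ∉ e := fun h => (h1 h).2 rfl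
    exact ⟨⟨fun y hy => (h1 hy).1, fun h => h2 ⟨h, hx⟩, fun f hf => (h3 f hf).1⟩, hx⟩
  · rintro ⟨⟨h1, h2, h3⟩, hx⟩
    exact ⟨fun y hy => ⟨h1 hy, fun h => hx (h ▸ hy)⟩, fun h => h2 h.1,
      fun f hf => ⟨h3 f hf, fun h => hx (hf.1 h)⟩⟩

theorem notMem_of_mem_clutter_link {x : α} {e : Set α}
    (he : e ∈ (Δ.link x).clutter.edgeSet) : x ∉ e := fun h => (he.1 h).2 rfl

/-- A minimal nonface `e` of the link of `x` is `E \ {x}` for a minimal nonface `E`. -/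
theorem mem_or_insert_mem_of_mem_clutter_link {x : α} (hx : x ∈ Δ.vertices) {e : Set α}
    (he : e ∈ (Δ.link x).clutter.edgeSet) :
    e ∈ Δ.clutter.edgeSet ∨ insert x e ∈ Δ.clutter.edgeSet := by
  have hxe := notMem_of_mem_clutter_link he
  obtain ⟨h1, h2, h3⟩ := he
  have hins : insert x e ∉ Δ.faces := fun h => h2 ⟨hxe, h⟩
  have hsub : e ⊆ Δ.vertices := fun y hy => (h1 hy).1
  by_cases hef : e ∈ Δ.faces
  · refine .inr ⟨Set.insert_subset hx hsub, hins, fun g hg => ?_⟩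
    by_cases hxg : x ∈ g
    · have hss : g \ {x} ⊂ e := by
        refine ⟨fun y hy => (hg.1 hy.1).resolve_left hy.2, fun h => hg.2 ?_⟩
        rintro y (rfl | hy)
        · exact hxg
        · exact (h hy).1
      have := (h3 _ hss).2
      rwa [Set.insert_sdiff_singleton, Set.insert_eq_of_mem hxg] at this
    · exact Δ.down_closed e hef g fun y hy => (hg.1 hy).resolve_left fun h => hxg (h ▸ hy)
  · exact .inl ⟨hsub, hef, fun f hf =>
      Δ.down_closed _ (h3 f hf).2 f (Set.subset_insert x f)⟩

/-- What is left of a minimal nonface in the link of `x` contains a minimal nonface of the link. -/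
theorem exists_link_edge_subset (hfin : Δ.vertices.Finite) {x : α} {F : Set α}
    (hF : F ∈ Δ.clutter.edgeSet) : ∃ e ∈ (Δ.link x).clutter.edgeSet, e ⊆ F \ {x} := by
  refine exists_edge_subset (Δ := Δ.link x) (hfin.subset Set.sdiff_subset)
    (fun y hy => ⟨hF.1 hy.1, hy.2⟩) fun h => ?_
  refine notMem_faces_of_subset hF ?_ h.2
  rw [Set.insert_sdiff_singleton]
  exact Set.subset_insert x F

theorem cycleFree_deletion {x : α} {n : ℕ} (h : Δ.clutter.CycleFree n) :
    (Δ.deletion x).clutter.CycleFree n := by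
  rintro ⟨y, E, hy, hE, hyE⟩
  exact h ⟨y, E, hy, hE, fun i => ⟨(mem_clutter_deletion.1 (hyE i).1).1, (hyE i).2⟩⟩

open Classical in
variable (Δ) in
/-- The minimal nonface of a complex from which a minimal nonface `e` of the link of `x` arises by
removing `x`. -/
noncomputable def liftEdge (x : α) (e : Set α) : Set α :=
  if e ∈ Δ.clutter.edgeSet then e else insert x e

theorem liftEdge_mem {x : α} (hx : x ∈ Δ.vertices) {e : Set α}
    (he : e ∈ (Δ.link x).clutter.edgeSet) : Δ.liftEdge x e ∈ Δ.clutter.edgeSet := by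
  unfold liftEdge
  split_ifs with h
  · exact h
  · exact (mem_or_insert_mem_of_mem_clutter_link hx he).resolve_left h

theorem subset_liftEdge {x : α} {e : Set α} : e ⊆ Δ.liftEdge x e := by
  unfold liftEdge
  split_ifs
  · exact subset_rfl
  · exact Set.subset_insert x e

theorem liftEdge_diff {x : α} {e : Set α} (he : e ∈ (Δ.link x).clutter.edgeSet) :
    Δ.liftEdge x e \ {x} = e := by
  have hxe := notMem_of_mem_clutter_link he
  unfold liftEdge
  split_ifs
  · exact Set.sdiff_singleton_eq_self hxe
  · exact Set.insert_sdiff_self_of_notMem hxe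

theorem liftEdge_injOn {x : α} : Set.InjOn (Δ.liftEdge x) (Δ.link x).clutter.edgeSet :=
  fun e he f hf hef => by
    rw [← liftEdge_diff he, ← liftEdge_diff hf, hef]

theorem cycleFree_link {x : α} (hx : x ∈ Δ.vertices) {n : ℕ} (h : Δ.clutter.CycleFree n) :
    (Δ.link x).clutter.CycleFree n := by
  rintro ⟨y, E, hy, hE, hyE⟩
  exact h ⟨y, fun i => Δ.liftEdge x (E i), hy,
    fun i j hij => hE (liftEdge_injOn (hyE i).1 (hyE j).1 hij),
    fun i => ⟨liftEdge_mem hx (hyE i).1, subset_liftEdge (hyE i).2.1, subset_liftEdge (hyE i).2.2⟩⟩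

theorem isSemiInducedMatching_of_deletion {x : α} {M : Set (Set α)}
    (hM : (Δ.deletion x).clutter.IsSemiInducedMatching M) :
    Δ.clutter.IsSemiInducedMatching M := by
  refine ⟨fun e he => (mem_clutter_deletion.1 (hM.1 he)).1, fun e he heM =>
    hM.2 e (mem_clutter_deletion.2 ⟨he, fun hx => ?_⟩) heM⟩
  obtain ⟨f, hf, hxf⟩ := heM hx
  exact (mem_clutter_deletion.1 (hM.1 hf)).2 hxf

end VertexComplex

/-! ### Semi induced matchings -/

namespace Hypergraph

variable {α : Type*} {H : Hypergraph α}

theorem CycleFree.eq_of_mem (h : H.CycleFree 2) {E F : Set α} (hE : E ∈ H.edgeSet)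
    (hF : F ∈ H.edgeSet) {a b : α} (hab : a ≠ b) (haE : a ∈ E) (hbE : b ∈ E) (haF : a ∈ F)
    (hbF : b ∈ F) : E = F := by
  by_contra hne
  refine h ⟨![a, b], ![E, F], ?_, ?_, ?_⟩
  · intro i j
    fin_cases i <;> fin_cases j <;> simp [hab, hab.symm]
  · intro i j
    fin_cases i <;> fin_cases j <;> simp [hne, Ne.symm hne]
  · intro i
    fin_cases i
    · exact ⟨hE, haE, hbE⟩
    · exact ⟨hF, hbF, haF⟩

theorem hasCycle_five {x y₁ z₁ z₂ y₂ : α} {E₁ F₁ G F₂ E₂ : Set α}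
    (hx : [x, y₁, z₁, z₂, y₂].Nodup) (hE : [E₁, F₁, G, F₂, E₂].Nodup)
    (h₁ : E₁ ∈ H.edgeSet ∧ x ∈ E₁ ∧ y₁ ∈ E₁) (h₂ : F₁ ∈ H.edgeSet ∧ y₁ ∈ F₁ ∧ z₁ ∈ F₁)
    (h₃ : G ∈ H.edgeSet ∧ z₁ ∈ G ∧ z₂ ∈ G) (h₄ : F₂ ∈ H.edgeSet ∧ z₂ ∈ F₂ ∧ y₂ ∈ F₂)
    (h₅ : E₂ ∈ H.edgeSet ∧ y₂ ∈ E₂ ∧ x ∈ E₂) : H.HasCycle 5 := by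
  refine ⟨[x, y₁, z₁, z₂, y₂].get, [E₁, F₁, G, F₂, E₂].get, List.nodup_iff_injective_get.1 hx,
    List.nodup_iff_injective_get.1 hE, fun i => ?_⟩
  fin_cases i
  · exact h₁
  · exact h₂
  · exact h₃
  · exact h₄
  · exact h₅

theorem finite_of_subset_edgeSet (hfin : H.vertexSet.Finite) {M : Set (Set α)}
    (hM : M ⊆ H.edgeSet) : M.Finite :=
  hfin.finite_subsets.subset fun _ he => H.subset_vertexSet_of_mem_edgeSet' (hM he)

theorem sUnion_subset_vertexSet {M : Set (Set α)} (hM : M ⊆ H.edgeSet) : ⋃₀ M ⊆ H.vertexSet :=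
  Set.sUnion_subset fun _ he => H.subset_vertexSet_of_mem_edgeSet' (hM he)

/-- Edges with a single vertex contribute nothing to `|⋃ M| - |M|` and may be dropped. -/
theorem IsSemiInducedMatching.exists_nontrivial (hfin : H.vertexSet.Finite) (hs : H.IsSimple)
    (hne : ∅ ∉ H.edgeSet) {M : Set (Set α)} (hM : H.IsSemiInducedMatching M) :
    ∃ M', H.IsSemiInducedMatching M' ∧ (∀ e ∈ M', e.Nontrivial) ∧
      (⋃₀ M).ncard + M'.ncard ≤ (⋃₀ M').ncard + M.ncard := by
  have hMfin := finite_of_subset_edgeSet hfin hM.1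
  have hUfin := hfin.subset (sUnion_subset_vertexSet hM.1)
  have hsub : ∀ e ∈ M, ¬ e.Nontrivial → ∀ y ∈ e, {y} = e := fun e he hnt y hy =>
    (Set.Subsingleton.eq_singleton_of_mem (Set.not_nontrivial_iff.1 hnt) hy).symm
  refine ⟨{e ∈ M | e.Nontrivial}, ⟨fun e he => hM.1 he.1, fun e he heU => ?_⟩,
    fun e he => he.2, ?_⟩
  · have heM := hM.2 e he (heU.trans (Set.sUnion_subset_sUnion fun e he => he.1))
    refine ⟨heM, ?_⟩
    by_contra hnt
    obtain ⟨y, hy⟩ := Set.nonempty_iff_ne_empty.2 fun h => hne (h ▸ he)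
    obtain ⟨f, hf, hyf⟩ := heU hy
    have hef : e = f := hs e he f (hM.1 hf.1) (by
      rw [← hsub e heM hnt y hy]; exact Set.singleton_subset_iff.2 hyf)
    exact hnt (hef ▸ hf.2)
  · have hU : ⋃₀ M ⊆ ⋃₀ {e ∈ M | e.Nontrivial} ∪ ⋃₀ {e ∈ M | ¬ e.Nontrivial} := by
      rintro y ⟨e, he, hy⟩
      by_cases h : e.Nontrivial
      · exact .inl ⟨e, ⟨he, h⟩, hy⟩
      · exact .inr ⟨e, ⟨he, h⟩, hy⟩
    have hM2 : M.ncard = {e ∈ M | e.Nontrivial}.ncard + {e ∈ M | ¬ e.Nontrivial}.ncard := by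
      rw [← Set.ncard_union_eq (Set.disjoint_left.2 fun e h h' => h'.2 h.2)
        (hMfin.subset fun e h => h.1) (hMfin.subset fun e h => h.1)]
      congr 1
      ext e
      simp only [Set.mem_union, Set.mem_ofPred_eq]
      tauto
    have h1 := Set.ncard_le_ncard hU
      ((hUfin.subset (Set.sUnion_subset_sUnion fun e he => he.1)).union
      (hUfin.subset (Set.sUnion_subset_sUnion fun e he => he.1)))
    have h2 := Set.ncard_union_le (⋃₀ {e ∈ M | e.Nontrivial}) (⋃₀ {e ∈ M | ¬ e.Nontrivial})
    have h3 : (⋃₀ {e ∈ M | ¬ e.Nontrivial}).ncard ≤ {e ∈ M | ¬ e.Nontrivial}.ncard := by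
      refine Set.ncard_le_ncard_of_injOn (fun y => {y}) ?_ Set.singleton_injective.injOn
        (hMfin.subset fun e h => h.1)
      rintro y ⟨e, he, hy⟩
      rw [hsub e he.1 he.2 y hy]
      exact he
    omega

end Hypergraph

namespace VertexComplex

variable {α : Type*} {Δ : VertexComplex α} {x : α} {M : Set (Set α)}

/-- A semi induced matching of the link of `x` some of whose edges come from edges containing `x`:
the corresponding edges of the complex form a semi induced matching with one more vertex. -/
theorem exists_matching_of_insert_mem (hfin : Δ.vertices.Finite) (hx : x ∈ Δ.vertices)
    (h2 : Δ.clutter.CycleFree 2)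
    (hM : (Δ.link x).clutter.IsSemiInducedMatching M) (hnt : ∀ e ∈ M, e.Nontrivial)
    (hex : ∃ e ∈ M, e ∉ Δ.clutter.edgeSet) :
    ∃ M', Δ.clutter.IsSemiInducedMatching M' ∧
      (⋃₀ M').ncard = (⋃₀ M).ncard + 1 ∧ M'.ncard = M.ncard := by
  have hxU : x ∉ ⋃₀ M := fun ⟨e, he, h⟩ => notMem_of_mem_clutter_link (hM.1 he) h
  have hUfin : (⋃₀ M).Finite :=
    hfin.subset ((Hypergraph.sUnion_subset_vertexSet hM.1).trans Set.sdiff_subset)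
  have hU : ⋃₀ (Δ.liftEdge x '' M) = insert x (⋃₀ M) := by
    apply Set.Subset.antisymm
    · rintro y ⟨_, ⟨e, he, rfl⟩, hy⟩
      by_cases hyx : y = x
      · exact .inl hyx
      · exact .inr ⟨e, he, by rw [← liftEdge_diff (hM.1 he)]; exact ⟨hy, hyx⟩⟩
    · rintro y (rfl | ⟨e, he, hy⟩)
      · obtain ⟨e, he, h⟩ := hex
        exact ⟨_, ⟨e, he, rfl⟩, by rw [liftEdge, if_neg h]; exact Set.mem_insert y e⟩
      · exact ⟨_, ⟨e, he, rfl⟩, subset_liftEdge hy⟩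
  refine ⟨Δ.liftEdge x '' M, ⟨?_, fun F hF hFU => ?_⟩, ?_, ?_⟩
  · rintro _ ⟨e, he, rfl⟩
    exact liftEdge_mem hx (hM.1 he)
  · rw [hU] at hFU
    obtain ⟨e, he, heF⟩ := exists_link_edge_subset hfin (x := x) hF
    have heM : e ∈ M := hM.2 e he fun y hy =>
      (hFU (heF hy).1).resolve_left (heF hy).2
    -- two vertices of `e` lie both in `F` and in the lift of `e`
    obtain ⟨a, ha, b, hb, hab⟩ := hnt e heM
    exact ⟨e, heM, h2.eq_of_mem (liftEdge_mem hx he) hF hab (subset_liftEdge ha)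
      (subset_liftEdge hb) (heF ha).1 (heF hb).1⟩
  · rw [hU, Set.ncard_insert_of_notMem hxU hUfin]
  · exact (liftEdge_injOn.mono hM.1).ncard_image

/-- Let `M` be a semi induced matching of the link of the shedding vertex `x` whose edges are edges
of the complex. Then some edge through `x` spans no further edge together with `⋃ M`. Otherwise,
each edge `E` through `x` has a companion edge `F ⊆ ⋃ M ∪ E` meeting `E` in one vertex `y`. The
sets `F \ {y}` together contain no edge, since such an edge would close a cycle of length five; a
maximal face of the link that contains all of them is then a facet of the deletion. -/
theorem exists_edge_of_shedding (hfin : Δ.vertices.Finite) (hx : x ∈ Δ.vertices)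
    (h2 : Δ.clutter.CycleFree 2) (h5 : Δ.clutter.CycleFree 5)
    (hshed : ∀ F ∈ (Δ.deletion x).facets, F ∈ Δ.facets) (hvoid : {x} ∈ Δ.faces)
    (hM : (Δ.link x).clutter.IsSemiInducedMatching M) (hMΔ : M ⊆ Δ.clutter.edgeSet) :
    ∃ E ∈ Δ.clutter.edgeSet, x ∈ E ∧
      ∀ F ∈ Δ.clutter.edgeSet, F ⊆ ⋃₀ M ∪ E → F = E ∨ F ∈ M := by
  have hxU : x ∉ ⋃₀ M := fun ⟨e, he, h⟩ => notMem_of_mem_clutter_link (hM.1 he) h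
  -- an edge whose vertices other than `x` are covered by `M` belongs to `M`
  have hcover : ∀ F ∈ Δ.clutter.edgeSet, F \ {x} ⊆ ⋃₀ M → F ∈ M := fun F hF hFU => by
    obtain ⟨e, he, heF⟩ := exists_link_edge_subset hfin (x := x) hF
    have heM := hM.2 e he (heF.trans hFU)
    rwa [← clutter_isSimple e (hMΔ heM) F hF (heF.trans Set.sdiff_subset)]
  have hcover' : ∀ F ∈ Δ.clutter.edgeSet, x ∈ F → ¬ F \ {x} ⊆ ⋃₀ M := fun F hF hxF h =>
    hxU ⟨F, hcover F hF h, hxF⟩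
  by_contra! hcon
  have key : ∀ E, E ∈ Δ.clutter.edgeSet ∧ x ∈ E → ∃ F y, F ∈ Δ.clutter.edgeSet ∧ x ∉ F ∧
      y ∈ F ∧ y ∈ E ∧ y ∉ ⋃₀ M ∧ F \ {y} ⊆ ⋃₀ M := by
    rintro E ⟨hE, hxE⟩
    obtain ⟨F, hF, hFU, hFE, hFM⟩ := hcon E hE hxE
    have hxF : x ∉ F := fun hxF => hcover' F hF hxF fun w hw =>
      (hFU hw.1).resolve_right fun hwE =>
        hFE (h2.eq_of_mem hF hE (Ne.symm hw.2) hxF hw.1 hxE hwE)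
    obtain ⟨y, hyF, hyU⟩ := Set.not_subset.1 fun h : F ⊆ ⋃₀ M =>
      hFM (hcover F hF (Set.sdiff_subset.trans h))
    have hyE := (hFU hyF).resolve_left hyU
    exact ⟨F, y, hF, hxF, hyF, hyE, hyU, fun w hw => (hFU hw.1).resolve_right fun hwE =>
      hFE (h2.eq_of_mem hF hE (Ne.symm hw.2) hyF hw.1 hyE hwE)⟩
  have : Nonempty α := ⟨x⟩
  choose! F y hF hxF hyF hyE hyU hFU using key
  let B : Set α := {z | ∃ E, (E ∈ Δ.clutter.edgeSet ∧ x ∈ E) ∧ z ∈ F E \ {y E}}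
  have hBU : B ⊆ ⋃₀ M := by
    rintro z ⟨E, hE, hz⟩
    exact hFU E hE hz
  have hB : ∀ G ∈ Δ.clutter.edgeSet, ¬ G ⊆ B := by
    intro G hG hGB
    obtain ⟨z₁, hz₁⟩ : G.Nonempty := by
      rw [Set.nonempty_iff_ne_empty]
      rintro rfl
      exact hG.2.1 (Δ.down_closed _ hvoid _ (Set.empty_subset _))
    obtain ⟨E₁, hE₁, hzF₁⟩ := hGB hz₁
    have hFG₁ : F E₁ ≠ G := fun h => hyU E₁ hE₁ (hBU (hGB (h ▸ hyF E₁ hE₁)))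
    obtain ⟨z₂, hz₂, hz₂F₁⟩ := Set.not_subset.1 fun h : G ⊆ F E₁ =>
      hFG₁ (clutter_isSimple G hG _ (hF E₁ hE₁) h).symm
    obtain ⟨E₂, hE₂, hzF₂⟩ := hGB hz₂
    have hFG₂ : F E₂ ≠ G := fun h => hyU E₂ hE₂ (hBU (hGB (h ▸ hyF E₂ hE₂)))
    have hEE : E₁ ≠ E₂ := by
      rintro rfl
      exact hz₂F₁ hzF₂.1
    have hxy₁ : x ≠ y E₁ := fun h => hxF E₁ hE₁ (h ▸ hyF E₁ hE₁)
    have hxy₂ : x ≠ y E₂ := fun h => hxF E₂ hE₂ (h ▸ hyF E₂ hE₂)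
    have hU₁ := hBU (hGB hz₁)
    have hU₂ := hBU (hGB hz₂)
    have hxG : x ∉ G := fun h => hxU (hBU (hGB h))
    have hz : ∀ {a b : α}, a ∉ ⋃₀ M → b ∈ ⋃₀ M → a ≠ b := fun ha hb h => ha (h ▸ hb)
    have hE : ∀ {a : α} {A B : Set α}, a ∈ A → a ∉ B → A ≠ B := fun ha hb h => hb (h ▸ ha)
    refine h5 (Hypergraph.hasCycle_five (x := x) (y₁ := y E₁) (z₁ := z₁) (z₂ := z₂) (y₂ := y E₂)
      (E₁ := E₁) (F₁ := F E₁) (G := G) (F₂ := F E₂) (E₂ := E₂) ?_ ?_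
      ⟨hE₁.1, hE₁.2, hyE E₁ hE₁⟩ ⟨hF E₁ hE₁, hyF E₁ hE₁, hzF₁.1⟩ ⟨hG, hz₁, hz₂⟩
      ⟨hF E₂ hE₂, hzF₂.1, hyF E₂ hE₂⟩ ⟨hE₂.1, hyE E₂ hE₂, hE₂.2⟩)
    · have hyy : y E₁ ≠ y E₂ := fun h => hEE
        (h2.eq_of_mem hE₁.1 hE₂.1 hxy₁ hE₁.2 (hyE E₁ hE₁) hE₂.2 (h ▸ hyE E₂ hE₂))
      have hzz : z₁ ≠ z₂ := fun h => hz₂F₁ (h ▸ hzF₁.1)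
      simp [hxy₁, hxy₂, hz hxU hU₁, hz hxU hU₂, hyy, hzz, hz (hyU E₁ hE₁) hU₁,
        hz (hyU E₁ hE₁) hU₂, (hz (hyU E₂ hE₂) hU₁).symm, (hz (hyU E₂ hE₂) hU₂).symm]
    · have hFF : F E₁ ≠ F E₂ := (hE hzF₂.1 hz₂F₁).symm
      simp [hE hE₁.2 (hxF E₁ hE₁), hE hE₁.2 (hxF E₂ hE₂), hE hE₁.2 hxG, hEE, hFG₁, hFF,
        (hE hE₂.2 (hxF E₁ hE₁)).symm, (hE hE₂.2 (hxF E₂ hE₂)).symm, (hE hE₂.2 hxG).symm,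
        hFG₂.symm]
  have hxB : x ∉ B := fun h => hxU (hBU h)
  have hBlink : B ∈ (Δ.link x).faces := by
    refine ⟨hxB, ?_⟩
    by_contra hnf
    obtain ⟨G, hG, hGB⟩ := exists_edge_subset hfin (Set.insert_subset hx (hBU.trans
      ((Hypergraph.sUnion_subset_vertexSet hMΔ)))) hnf
    by_cases hxG : x ∈ G
    · exact hcover' G hG hxG fun w hw => hBU ((hGB hw.1).resolve_left hw.2)
    · exact hB G hG fun w hw => (hGB hw).resolve_left fun h => hxG (h ▸ hw)
  obtain ⟨A, hA, hBA⟩ := exists_facet_superset (hfin.subset Set.sdiff_subset) hBlink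
  have hAdel : A ∈ (Δ.deletion x).facets := by
    refine ⟨⟨Δ.down_closed _ hA.1.2 _ (Set.subset_insert x A), hA.1.1⟩, fun G hG hAG => ?_⟩
    refine Set.Subset.antisymm (fun v hv => ?_) hAG
    by_contra hvA
    have hvx : v ≠ x := fun h => hG.2 (h ▸ hv)
    have hvAf : insert v A ∈ Δ.faces := Δ.down_closed _ hG.1 _ (Set.insert_subset hv hAG)
    have hxvA : x ∉ insert v A := fun h => h.elim (fun h => hvx h.symm) hA.1.1
    have hnf : insert x (insert v A) ∉ Δ.faces := fun h =>
      hvA (hA.2 (insert v A) ⟨hxvA, h⟩ (Set.subset_insert v A) ▸ Set.mem_insert v A)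
    obtain ⟨E, hE, hEs⟩ := exists_edge_subset hfin
      (Set.insert_subset hx (Δ.subset_vertices _ hvAf)) hnf
    have hxE : x ∈ E := by
      by_contra hxE
      exact notMem_faces_of_subset hE (fun w hw => (hEs hw).resolve_left fun h => hxE (h ▸ hw)) hvAf
    have hEx : E ∈ Δ.clutter.edgeSet ∧ x ∈ E := ⟨hE, hxE⟩
    refine notMem_faces_of_subset (hF E hEx) (fun w hw => ?_) hvAf
    by_cases hwy : w = y E
    · subst hwy
      exact (hEs (hyE E hEx)).resolve_left fun h => hxF E hEx (h ▸ hw)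
    · exact .inr (hBA ⟨E, hEx, hw, hwy⟩)
  exact hA.1.1 ((hshed A hAdel).2 _ hA.1.2 (Set.subset_insert x A) ▸ Set.mem_insert x A)

/-- Passing to the link of a shedding vertex decreases the semi induced matching number. -/
theorem exists_matching_of_link (hfin : Δ.vertices.Finite) (hx : x ∈ Δ.vertices)
    (h2 : Δ.clutter.CycleFree 2) (h5 : Δ.clutter.CycleFree 5)
    (hshed : ∀ F ∈ (Δ.deletion x).facets, F ∈ Δ.facets) (hvoid : {x} ∈ Δ.faces)
    (hM : (Δ.link x).clutter.IsSemiInducedMatching M) :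
    ∃ M', Δ.clutter.IsSemiInducedMatching M' ∧
      (⋃₀ M).ncard + M'.ncard + 1 ≤ (⋃₀ M').ncard + M.ncard := by
  have hlfin : (Δ.link x).clutter.vertexSet.Finite := hfin.subset Set.sdiff_subset
  obtain ⟨M₁, hM₁, hnt, hle⟩ := hM.exists_nontrivial hlfin clutter_isSimple
    (fun h => h.2.1 ⟨Set.notMem_empty x, by simpa using hvoid⟩)
  by_cases hex : ∃ e ∈ M₁, e ∉ Δ.clutter.edgeSet
  · obtain ⟨M', hM', h, h'⟩ := exists_matching_of_insert_mem hfin hx h2 hM₁ hnt hex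
    exact ⟨M', hM', by omega⟩
  · push Not at hex
    obtain ⟨E, hE, hxE, hEM⟩ := exists_edge_of_shedding hfin hx h2 h5 hshed hvoid hM₁ hex
    have hxU : x ∉ ⋃₀ M₁ := fun ⟨e, he, h⟩ => notMem_of_mem_clutter_link (hM₁.1 he) h
    have hU : ⋃₀ insert E M₁ = ⋃₀ M₁ ∪ E := by rw [Set.sUnion_insert, Set.union_comm]
    refine ⟨insert E M₁, ⟨Set.insert_subset hE hex, fun F hF hFU => hEM F hF (hU ▸ hFU)⟩, ?_⟩
    rw [Set.ncard_insert_of_notMem (fun h => hxU ⟨E, h, hxE⟩)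
      (Hypergraph.finite_of_subset_edgeSet hlfin hM₁.1), hU]
    -- besides `x`, the edge `E` has another vertex `z` outside `⋃ M₁`
    obtain ⟨z, hz, hzU⟩ : ∃ z ∈ E \ {x}, z ∉ ⋃₀ M₁ := by
      refine Set.not_subset.1 fun h => ?_
      obtain ⟨e, he, heE⟩ := exists_link_edge_subset hfin (x := x) hE
      have heM := hM₁.2 e he (heE.trans h)
      have := clutter_isSimple e (hex e heM) E hE (heE.trans Set.sdiff_subset)
      exact (heE (this ▸ hxE)).2 rfl
    have hUfin : (⋃₀ M₁).Finite := hlfin.subset (Hypergraph.sUnion_subset_vertexSet hM₁.1)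
    have hcard : (insert x (insert z (⋃₀ M₁))).ncard = (⋃₀ M₁).ncard + 2 := by
      rw [Set.ncard_insert_of_notMem (fun h => h.elim (fun h => hz.2 h.symm) hxU)
        (hUfin.insert z), Set.ncard_insert_of_notMem hzU hUfin]
    have := Set.ncard_le_ncard (Set.insert_subset (.inr hxE) (Set.insert_subset (.inr hz.1)
      (Set.subset_union_left))) (hUfin.union (hfin.subset hE.1))
    omega

end VertexComplex

/-! ### Regularity of vertex decomposable complexes -/

namespace VertexComplex

variable {α : Type*} {Δ : VertexComplex α}

variable (Δ) in
/-- The sets of elements of `V` whose part in the vertex set of `Δ` is not a face of `Δ`. Elements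
of `V` outside the vertex set of `Δ` are cone points, and the associated squarefree monomial ideal
in the variables `V` is the extension of the Stanley-Reisner ideal of `Δ`. -/
def nonfaces (V : Set α) : UpperSet (Set V) where
  carrier := {S | Subtype.val '' S ∩ Δ.vertices ∉ Δ.faces}
  upper' _ _ hST hS h := hS (Δ.down_closed _ h _
    (Set.inter_subset_inter_left _ (Set.image_mono hST)))

theorem mem_nonfaces {V : Set α} {S : Set V} :
    S ∈ Δ.nonfaces V ↔ Subtype.val '' S ∩ Δ.vertices ∉ Δ.faces := Iff.rfl

theorem nonfaces_link {V : Set α} {v : V} (hv : v.1 ∈ Δ.vertices) (S : Set V) :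
    S ∈ (Δ.link v).nonfaces V ↔ insert v S ∈ Δ.nonfaces V := by
  have h1 : v.1 ∉ Subtype.val '' S ∩ (Δ.link v).vertices := fun h => h.2.2 rfl
  have h2 : insert v.1 (Subtype.val '' S ∩ (Δ.link v).vertices) =
      Subtype.val '' (insert v S) ∩ Δ.vertices := by
    rw [Set.image_insert_eq]
    ext y
    by_cases hy : y = v
    · simp [hy, hv]
    · simp [hy, link]
  rw [mem_nonfaces, mem_nonfaces, ← h2]
  exact not_congr ⟨fun h => h.2, fun h => ⟨h1, h⟩⟩

theorem nonfaces_deletion {V : Set α} (v : V) (S : Set V) :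
    S ∈ (Δ.deletion v).nonfaces V ↔ S \ {v} ∈ Δ.nonfaces V := by
  have h1 : v.1 ∉ Subtype.val '' S ∩ (Δ.deletion v).vertices := fun h => h.2.2 rfl
  have h2 : Subtype.val '' S ∩ (Δ.deletion v).vertices =
      Subtype.val '' (S \ {v}) ∩ Δ.vertices := by
    rw [Set.image_sdiff Subtype.val_injective, Set.image_singleton]
    ext y
    simp only [deletion, Set.mem_inter_iff, Set.mem_sdiff]
    tauto
  rw [mem_nonfaces, mem_nonfaces, ← h2]
  exact not_congr ⟨fun h => h.1, fun h => ⟨h, h1⟩⟩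

theorem VertexDecomposable.regularityLE (K : Type*) [Field K] (hΔ : Δ.VertexDecomposable)
    {V : Set α} [Fintype V] (hV : Δ.vertices ⊆ V) (h2 : Δ.clutter.CycleFree 2)
    (h5 : Δ.clutter.CycleFree 5) {r : ℤ}
    (hr : ∀ M, Δ.clutter.IsSemiInducedMatching M → ((⋃₀ M).ncard : ℤ) - M.ncard ≤ r) :
    SquarefreeIdeal.RegularityLE K (Δ.nonfaces V) r := by
  induction hΔ generalizing r with
  | simplex Δ h =>
    have hface : Δ.vertices ∈ Δ.faces := (h ▸ Set.mem_singleton _ : Δ.vertices ∈ Δ.facets).1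
    refine SquarefreeIdeal.regularityLE_of_forall_notMem
      (fun S hS => mem_nonfaces.1 hS (Δ.down_closed _ hface _ Set.inter_subset_right)) ?_
    simpa using hr ∅ ⟨Set.empty_subset _, fun e he _ =>
      absurd (Δ.down_closed _ hface e he.1) he.2.1⟩
  | void Δ h =>
    exact SquarefreeIdeal.regularityLE_of_forall_mem (fun S => by simp [mem_nonfaces, h]) r
  | shedding Δ x hx _ _ hshed ihdel ihlink =>
    refine SquarefreeIdeal.regularityLE_of_link_of_deletion (v := ⟨x, hV hx⟩)
      (nonfaces_link hx) (nonfaces_deletion _) ?_ ?_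
    · by_cases hvoid : {x} ∈ Δ.faces
      · refine ihlink (Set.sdiff_subset.trans hV) (cycleFree_link hx h2) (cycleFree_link hx h5)
          fun M hM => ?_
        obtain ⟨M', hM', h⟩ := exists_matching_of_link (V.toFinite.subset hV) hx h2 h5 hshed
          hvoid hM
        have := hr M' hM'
        omega
      · refine SquarefreeIdeal.regularityLE_of_forall_mem (fun S => ?_) _
        refine mem_nonfaces.2 fun hS => hvoid ?_
        exact Δ.down_closed _ hS.2 _ (Set.singleton_subset_iff.2 (Set.mem_insert x _))
    · exact ihdel (Set.sdiff_subset.trans hV) (cycleFree_deletion h2) (cycleFree_deletion h5)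
        fun M hM => hr M (isSemiInducedMatching_of_deletion hM)

open MvPolynomial in
theorem stanleyReisnerIdeal_eq (K : Type*) [Field K] :
    Δ.stanleyReisnerIdeal K = SquarefreeIdeal.ofUpperSet K (Δ.nonfaces Δ.vertices) := by
  classical
  have hinter : ∀ S : Set Δ.vertices, Subtype.val '' S ∩ Δ.vertices = Subtype.val '' S := fun S =>
    Set.inter_eq_left.2 (Subtype.coe_image_subset _ S)
  have hprod : ∀ F : Finset Δ.vertices, ∏ x ∈ F, (X x : MvPolynomial Δ.vertices K) =
      monomial (∑ x ∈ F, Finsupp.single x 1) 1 := fun F => by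
    rw [monomial_sum_one]
    rfl
  have hle : ∀ (F : Finset Δ.vertices) (m : Δ.vertices →₀ ℕ),
      ∑ x ∈ F, Finsupp.single x 1 ≤ m ↔ F ⊆ m.support := fun F m => by
    have hval : ∀ y, (∑ x ∈ F, Finsupp.single x 1 : Δ.vertices →₀ ℕ) y = if y ∈ F then 1 else 0 :=
      fun y => by simp [Finsupp.finsetSum_apply, Finsupp.single_apply]
    constructor
    · intro h y hy
      have := h y
      rw [hval, if_pos hy] at this
      exact Finsupp.mem_support_iff.2 (by omega)
    · intro h y
      rw [hval]
      split_ifs with hy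
      · exact Nat.one_le_iff_ne_zero.2 (Finsupp.mem_support_iff.1 (h hy))
      · exact Nat.zero_le _
  apply le_antisymm
  · refine Ideal.span_le.2 ?_
    rintro _ ⟨F, hF, rfl⟩
    rw [SetLike.mem_coe, SquarefreeIdeal.mem_ofUpperSet]
    intro m hm
    rw [hprod, coeff_monomial] at hm
    split_ifs at hm with h
    · refine (Δ.nonfaces Δ.vertices).upper
        (Finset.coe_subset.2 ((hle F m).1 h.le)) ?_
      exact mem_nonfaces.2 (by rwa [hinter])
    · exact absurd rfl hm
  · intro p hp
    rw [p.as_sum]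
    refine Ideal.sum_mem _ fun m hm => ?_
    have hmem : (monomial (∑ x ∈ m.support, Finsupp.single x 1) 1 : MvPolynomial Δ.vertices K) ∈
        Δ.stanleyReisnerIdeal K := by
      refine Ideal.subset_span ⟨m.support, ?_, (hprod _).symm⟩
      have := hp m (mem_support_iff.1 hm)
      rwa [mem_nonfaces, hinter] at this
    refine Ideal.mem_of_dvd _ ?_ hmem
    exact monomial_dvd_monomial.2 ⟨.inr ((hle _ m).2 subset_rfl), one_dvd _⟩

end VertexComplex

/-! ### Matching numbers -/

namespace Hypergraph

variable {α : Type*} {H : Hypergraph α}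

theorem clutter_independenceComplex (hs : H.IsSimple) : H.independenceComplex.clutter = H := by
  refine Hypergraph.ext rfl (Set.ext fun e => ⟨fun ⟨h1, h2, h3⟩ => ?_, fun he => ?_⟩)
  · have : ∃ f ∈ H.edgeSet, f ⊆ e := by
      by_contra! h
      exact h2 ⟨h1, h⟩
    obtain ⟨f, hf, hfe⟩ := this
    by_contra he
    exact (h3 f (hfe.ssubset_of_ne fun h => he (h ▸ hf))).2 f hf subset_rfl
  · have heV := H.subset_vertexSet_of_mem_edgeSet' he
    refine ⟨heV, fun h => h.2 e he subset_rfl, fun g hg => ⟨hg.1.trans heV, fun f hf hfg => ?_⟩⟩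
    have := hs f hf e he (hfg.trans hg.1)
    exact hg.2 (this ▸ hfg)

theorem isSemiInducedMatching_empty (hne : ∅ ∉ H.edgeSet) : H.IsSemiInducedMatching ∅ :=
  ⟨Set.empty_subset _, fun e he h => absurd (Set.subset_empty_iff.1 (by simpa using h) ▸ he) hne⟩

/-- Removing one vertex from each edge of a semi induced matching leaves a face. -/
theorem IsSemiInducedMatching.exists_face (hfin : H.vertexSet.Finite) (hne : ∅ ∉ H.edgeSet)
    {M : Set (Set α)} (hM : H.IsSemiInducedMatching M) :
    ∃ F ∈ H.independenceComplex.faces, (⋃₀ M).ncard ≤ F.ncard + M.ncard := by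
  have hMfin := finite_of_subset_edgeSet hfin hM.1
  have hex : ∀ e ∈ M, ∃ v, v ∈ e := fun e he =>
    Set.nonempty_iff_ne_empty.2 fun h => hne (h ▸ hM.1 he)
  by_cases hα : Nonempty α
  · choose! v hv using hex
    refine ⟨⋃₀ M \ v '' M, ⟨Set.sdiff_subset.trans (sUnion_subset_vertexSet hM.1),
      fun e he heF => ?_⟩, ?_⟩
    · have heM := hM.2 e he (heF.trans Set.sdiff_subset)
      exact (heF (hv e heM)).2 ⟨e, heM, rfl⟩
    · have h1 := Set.ncard_le_ncard_sdiff_add_ncard (⋃₀ M) (v '' M) (hMfin.image v)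
      have h2 := Set.ncard_image_le (f := v) hMfin
      omega
  · rw [not_nonempty_iff] at hα
    refine ⟨∅, ⟨Set.empty_subset _, fun e he h => hne (Set.subset_empty_iff.1 h ▸ he)⟩, ?_⟩
    simp [Set.eq_empty_of_isEmpty (⋃₀ M)]

theorem bddAbove_semiInduced (hfin : H.vertexSet.Finite) :
    BddAbove {m : ℤ | ∃ M, H.IsSemiInducedMatching M ∧
      m = ((⋃₀ M).ncard : ℤ) - (M.ncard : ℤ)} := by
  refine ⟨H.vertexSet.ncard, ?_⟩
  rintro _ ⟨M, hM, rfl⟩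
  have := Set.ncard_le_ncard (sUnion_subset_vertexSet hM.1) hfin
  omega

theorem inducedMatchingNumber_le (hfin : H.vertexSet.Finite) (hne : ∅ ∉ H.edgeSet) :
    H.inducedMatchingNumber ≤ H.semiInducedMatchingNumber := by
  refine csSup_le_csSup (bddAbove_semiInduced hfin)
    ⟨_, ∅, ⟨isSemiInducedMatching_empty hne, Set.pairwiseDisjoint_empty⟩, rfl⟩ ?_
  rintro _ ⟨M, hM, rfl⟩
  exact ⟨M, hM.1, rfl⟩

theorem semiInducedMatchingNumber_le (hfin : H.vertexSet.Finite) (hne : ∅ ∉ H.edgeSet) :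
    H.semiInducedMatchingNumber ≤ H.independenceComplex.dim + 1 := by
  refine csSup_le ⟨_, ∅, isSemiInducedMatching_empty hne, rfl⟩ ?_
  rintro _ ⟨M, hM, rfl⟩
  obtain ⟨F, hF, h⟩ := hM.exists_face hfin hne
  have hbdd : BddAbove {d : ℤ | ∃ F ∈ H.independenceComplex.faces, d = (F.ncard : ℤ) - 1} := by
    refine ⟨H.vertexSet.ncard, ?_⟩
    rintro _ ⟨F, hF, rfl⟩
    have := Set.ncard_le_ncard hF.1 hfin
    omega
  have : (F.ncard : ℤ) - 1 ≤ H.independenceComplex.dim := le_csSup hbdd ⟨F, hF, rfl⟩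
  omega

theorem stanleyReisnerRegularity_le (K : Type*) [Field K] (hfin : H.vertexSet.Finite)
    (hs : H.IsSimple) (h2 : H.CycleFree 2) (h5 : H.CycleFree 5) (hvd : H.VertexDecomposable) :
    H.independenceComplex.stanleyReisnerRegularity K ≤
      ((H.semiInducedMatchingNumber : ℝ) : EReal) := by
  have hcl := clutter_independenceComplex hs
  have : Fintype H.independenceComplex.vertices := hfin.fintype
  rw [VertexComplex.stanleyReisnerRegularity, VertexComplex.stanleyReisnerIdeal_eq]
  refine SquarefreeIdeal.regularity_le K (hvd.regularityLE K subset_rfl ?_ ?_ fun M hM => ?_)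
  · rwa [hcl]
  · rwa [hcl]
  · rw [hcl] at hM
    exact le_csSup (bddAbove_semiInduced hfin) ⟨M, hM, rfl⟩

end Hypergraph

theorem mainTheorem5 {α K : Type*} [Field K] (H : Hypergraph α)
    (hfin : H.vertexSet.Finite) (hsimple : H.IsSimple) (hne : ∅ ∉ H.edgeSet) :
    (H.inducedMatchingNumber ≤ H.semiInducedMatchingNumber ∧
      H.semiInducedMatchingNumber ≤ H.independenceComplex.dim + 1) ∧
    (H.CycleFree 2 → H.CycleFree 5 → H.VertexDecomposable →
      H.independenceComplex.stanleyReisnerRegularity K ≤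
          ((H.semiInducedMatchingNumber : ℝ) : EReal) ∧
        H.semiInducedMatchingNumber ≤ H.independenceComplex.dim + 1) :=
  ⟨⟨Hypergraph.inducedMatchingNumber_le hfin hne,
      Hypergraph.semiInducedMatchingNumber_le hfin hne⟩,
    fun h2 h5 hvd => ⟨Hypergraph.stanleyReisnerRegularity_le K hfin hsimple h2 h5 hvd,
      Hypergraph.semiInducedMatchingNumber_le hfin hne⟩⟩
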